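/- Let $n\in\{2,3\}$ and let $p=p_0(n)=\dfrac{n+1+\sqrt{n^2+10n-7}}{2(n-1)}$ be the Strauss exponent, i.e. the positive root of $1+\frac{n+1}{2}p-\frac{n-1}{2}p^2=0$. Let $f\equiv 0$ and let $g\in C^\infty(\mathbf R^n)$ (not necessarily of compact support) satisfy $g\ge 0$ and $g\not\equiv 0$. For $\varepsilon>0$ and $0<T<\infty$, a classical solution on $[0,T)$ is a real-valued function $u\in C^2(\mathbf R^n\times[0,T))$ such that $$u_{tt}-\Delta u=|u|^p\ \text{ in }\mathbf R^n\times(0,T),\qquad u(x,0)=\varepsilon f(x),\quad u_t(x,0)=\varepsilon g(x)\ \text{ for all } x\in\mathbf R^n .$$ Let $T(\varepsilon)\in[0,\infty]$ be the supremum of all finite $T>0$ for which a classical solution on $[0,T)$ exists (with $\sup\emptyset=0$). Then there are constants $C>0$ and $\varepsilon_0>0$, depending only on $n$, $p$ and $g$ (in particular not on $\varepsilon$), such that for every $0<\varepsilon\le\varepsilon_0$ no classical solution on $[0,T)$ exists for any $$T>\exp\left(C\varepsilon^{-p(p-1)}\right);$$ consequently $$T(\varepsilon)\le\exp\left(C\varepsilon^{-p(p-1)}\right).$$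 -/

import Mathlib

open scoped ContDiff Laplacian

noncomputable section

/-- The polynomial `γ(n,p) = 1 + (n+1)/2 p - (n-1)/2 p²`. -/
def straussGamma (n : ℕ) (p : ℝ) : ℝ :=
  1 + ((n : ℝ) + 1) / 2 * p - ((n : ℝ) - 1) / 2 * p ^ 2

/-- The Strauss exponent `p₀(n)`, meaningful for `n ≥ 2`. -/
def straussExponent (n : ℕ) : ℝ :=
  ((n : ℝ) + 1 + √((n : ℝ) ^ 2 + 10 * n - 7)) / (2 * ((n : ℝ) - 1))

/-- For `n ≥ 2` the Strauss exponent is the positive root of `γ(n, ·)`. -/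
theorem straussGamma_eq_zero_iff {n : ℕ} (hn : 2 ≤ n) {p : ℝ} (hp : 0 < p) :
    straussGamma n p = 0 ↔ p = straussExponent n := by
  have hn' : (2 : ℝ) ≤ n := by exact_mod_cast hn
  have h0 : (0 : ℝ) ≤ (n : ℝ) ^ 2 + 10 * n - 7 := by nlinarith
  have hs := Real.sq_sqrt h0
  have hs0 := Real.sqrt_nonneg ((n : ℝ) ^ 2 + 10 * n - 7)
  unfold straussGamma straussExponent
  rw [eq_div_iff (by linarith)]
  set s := √((n : ℝ) ^ 2 + 10 * n - 7)
  have key : (p * (2 * ((n : ℝ) - 1)) - (n + 1) - s) * (p * (2 * ((n : ℝ) - 1)) - (n + 1) + s)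
      = -8 * (n - 1) * (1 + ((n : ℝ) + 1) / 2 * p - ((n : ℝ) - 1) / 2 * p ^ 2) := by
    linear_combination -hs
  constructor
  · intro h
    rw [h, mul_zero] at key
    rcases mul_eq_zero.1 key with h1 | h1
    · linarith
    · exfalso
      have : (n : ℝ) + 1 < s := by nlinarith
      nlinarith
  · intro h
    have h1 : p * (2 * ((n : ℝ) - 1)) - (n + 1) - s = 0 := by linarith
    rw [h1, zero_mul] at key
    rcases mul_eq_zero.1 key.symm with h2 | h2
    · linarith
    · exact h2

/-- `u = u(x,t)` is a classical solution of `u_tt - Δu = |u|^p` in `ℝⁿ × (0,T)` with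
`u(x,0) = ε f(x)` and `u_t(x,0) = ε g(x)`: it is of class `C²` on `ℝⁿ × [0,T)` and satisfies
the equation and the initial conditions pointwise. The time derivative at `t = 0` is one-sided;
the values of `u` outside `[0,T)` are irrelevant. -/
structure IsClassicalSolution (n : ℕ) (p ε : ℝ) (f g : EuclideanSpace ℝ (Fin n) → ℝ) (T : ℝ)
    (u : EuclideanSpace ℝ (Fin n) → ℝ → ℝ) : Prop where
  contDiffOn : ContDiffOn ℝ 2 (fun z : EuclideanSpace ℝ (Fin n) × ℝ => u z.1 z.2)
    (Set.univ ×ˢ Set.Ico 0 T)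
  equation : ∀ x : EuclideanSpace ℝ (Fin n), ∀ t ∈ Set.Ioo 0 T,
    iteratedDeriv 2 (fun s : ℝ => u x s) t
      - (Δ (fun y : EuclideanSpace ℝ (Fin n) => u y t)) x = |u x t| ^ p
  initial : ∀ x, u x 0 = ε * f x
  initial_deriv : ∀ x, HasDerivWithinAt (fun s : ℝ => u x s) (ε * g x) (Set.Ici 0) 0

/-- The lifespan: the supremum (in `[0,∞]`) of all finite `T > 0` such that a classical solution
exists on `ℝⁿ × [0,T)`. -/
def lifespan (n : ℕ) (p : ℝ) (f g : EuclideanSpace ℝ (Fin n) → ℝ) (ε : ℝ) : ENNReal :=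
  sSup {τ : ENNReal | ∃ T : ℝ, 0 < T ∧ (∃ u, IsClassicalSolution n p ε f g T u) ∧
    τ = ENNReal.ofReal T}

end

/-! The source `|u|^p` and the data are nonnegative, so Kirchhoff's formula gives `u ≥ 0`, with
Hadamard descent when `n = 2` (`nonneg_of_wave`). Average `u` over spheres about a point `x₀` with
`g x₀ > 0`, and put `U = r ^ m ū`, `m = (n - 1) / 2`, in the coordinates `a = t + r`, `b = t - r`.
Darboux's equation, Jensen's inequality and `0 ≤ m ≤ 1` yield `∂_b ∂_a U ≥ (1/4) r ^ (m (1 - p)) U ^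
p`, with `U = 0` at `r = 0` and `∂_a U ≥ 0` at `t = 0`.

This inequality is used twice on the ray `t = 2r`, that is `(a, b) = (3y, y)`. The data force `U ≥ c
ε` in a strip `0 < b ≤ δ / 2` along the light cone; inserting this in the source gives `U(3y, y) ≥ c
ε ^ p y ^ (1 + m (1 - p))` (`line_lower_bound`). Inserting instead the values of `U` on the ray
itself gives `U(3y, y) ≥ c y ^ (m (1 - p)) W(y)`, where `W'' = U(3y, y) ^ p` and `W(0) = W'(0) = 0`
(`line_iteration`).

Together, `W'' ≥ c y ^ (-m p (p - 1)) (ε ^ p y + W) ^ p`. Criticality of `p` means `m p (p - 1) = p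
+ 1`, exactly the power for which `s = log y` and `f = ε ^ p + W / y` give an autonomous inequality
`f'' + f' ≥ c f ^ p`. As `f ≥ η = ε ^ p`, it survives at most for a time of order `η ^ (-(p - 1))`
in `s` (`exists_length_bound`); so `log T` is at most of order `ε ^ (-p (p - 1))`. -/

open MeasureTheory Set Filter Topology

noncomputable section

/-! ### Integrals with a parameter, for finite measures carried by a compact set. -/

section ParametricIntegral

variable {E : Type*} [TopologicalSpace E] [T2Space E] [MeasurableSpace E] [BorelSpace E]
  {μ : Measure E} {K : Set E}

theorem ContinuousOn.aestronglyMeasurable_of_ae_mem (hK : IsCompact K) (hμ : ∀ᵐ x ∂μ, x ∈ K)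
    {f : E → ℝ} (hf : ContinuousOn f K) : AEStronglyMeasurable f μ := by
  rw [← Measure.restrict_eq_self_of_ae_mem hμ]
  exact hf.aestronglyMeasurable hK.measurableSet

variable [IsFiniteMeasure μ]

theorem ContinuousOn.integrable_of_ae_mem (hK : IsCompact K) (hμ : ∀ᵐ x ∂μ, x ∈ K)
    {f : E → ℝ} (hf : ContinuousOn f K) : Integrable f μ := by
  obtain ⟨C, hC⟩ := hK.exists_bound_of_continuousOn hf
  refine Integrable.of_bound (hf.aestronglyMeasurable_of_ae_mem hK hμ) C ?_
  filter_upwards [hμ] with x hx using hC x hx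

theorem continuousOn_integral_of_ae_mem (hK : IsCompact K) (hμ : ∀ᵐ x ∂μ, x ∈ K) {J : Set ℝ}
    (hJ : IsCompact J) {F : E → ℝ → ℝ}
    (hF : ContinuousOn (fun z : E × ℝ => F z.1 z.2) (K ×ˢ J)) :
    ContinuousOn (fun s => ∫ x, F x s ∂μ) J := by
  obtain ⟨C, hC⟩ := (hK.prod hJ).exists_bound_of_continuousOn hF
  refine continuousOn_of_dominated (bound := fun _ => C) (fun s hs => ?_) (fun s hs => ?_)
    (integrable_const C) ?_
  · refine ContinuousOn.aestronglyMeasurable_of_ae_mem hK hμ ?_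
    exact hF.comp (f := fun x => (x, s)) (by fun_prop) (fun x hx => ⟨hx, hs⟩)
  · filter_upwards [hμ] with x hx using hC (x, s) ⟨hx, hs⟩
  · filter_upwards [hμ] with x hx
    exact hF.comp (f := fun s => (x, s)) (by fun_prop) (fun s hs => ⟨hx, hs⟩)

theorem hasDerivAt_integral_of_ae_mem (hK : IsCompact K) (hμ : ∀ᵐ x ∂μ, x ∈ K) {I : Set ℝ}
    (hI : IsOpen I) {F F' : E → ℝ → ℝ} (hd : ∀ x ∈ K, ∀ s ∈ I, HasDerivAt (F x) (F' x s) s)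
    (hF : ContinuousOn (fun z : E × ℝ => F z.1 z.2) (K ×ˢ I))
    (hF' : ContinuousOn (fun z : E × ℝ => F' z.1 z.2) (K ×ˢ I)) {s : ℝ} (hs : s ∈ I) :
    HasDerivAt (fun s => ∫ x, F x s ∂μ) (∫ x, F' x s ∂μ) s := by
  obtain ⟨r, hr, hrI⟩ := Metric.nhds_basis_closedBall.mem_iff.1 (hI.mem_nhds hs)
  have hJ : IsCompact (Metric.closedBall s r) := isCompact_closedBall s r
  obtain ⟨C, hC⟩ := (hK.prod hJ).exists_bound_of_continuousOn
    (hF'.mono (prod_mono_right hrI))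
  have slice : ∀ {G : E → ℝ → ℝ}, ContinuousOn (fun z : E × ℝ => G z.1 z.2) (K ×ˢ I) →
      ∀ t ∈ I, ContinuousOn (fun x => G x t) K := fun {G} hG t ht =>
    hG.comp (f := fun x => (x, t)) (by fun_prop) (fun x hx => ⟨hx, ht⟩)
  refine (hasDerivAt_integral_of_dominated_loc_of_deriv_le (F := fun s x => F x s)
    (F' := fun s x => F' x s) (bound := fun _ => C)
    (Metric.closedBall_mem_nhds s hr) ?_ ?_ ?_ ?_ (integrable_const C) ?_).2
  · filter_upwards [hI.mem_nhds hs] with t ht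
    exact (slice hF t ht).aestronglyMeasurable_of_ae_mem hK hμ
  · exact (slice hF s hs).integrable_of_ae_mem hK hμ
  · exact (slice hF' s hs).aestronglyMeasurable_of_ae_mem hK hμ
  · filter_upwards [hμ] with x hx t ht using hC (x, t) ⟨hx, ht⟩
  · filter_upwards [hμ] with x hx t ht using hd x hx t (hrI ht)

end ParametricIntegral

/-! ### The rotation invariant measure on the unit sphere. -/

section SphereMeasure

variable (E : Type*) [NormedAddCommGroup E] [InnerProductSpace ℝ E] [FiniteDimensional ℝ E]
  [MeasurableSpace E] [BorelSpace E]

/-- The rotation invariant probability measure on the unit sphere of `E`, seen as a measure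
on `E`. -/
def unitSphereMeasure : Measure E :=
  (ProbabilityTheory.cond volume (Metric.ball (0 : E) 1)).map (fun y => ‖y‖⁻¹ • y)

theorem measurable_normalize : Measurable (fun y : E => ‖y‖⁻¹ • y) := by fun_prop

instance : IsProbabilityMeasure (unitSphereMeasure E) := by
  have h : IsProbabilityMeasure (ProbabilityTheory.cond volume (Metric.ball (0 : E) 1)) :=
    ProbabilityTheory.cond_isProbabilityMeasure_of_finite
      (Metric.measure_ball_pos _ _ one_pos).ne' measure_ball_lt_top.ne
  exact Measure.isProbabilityMeasure_map (measurable_normalize E).aemeasurable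

theorem ae_norm_eq_one_unitSphereMeasure [Nontrivial E] :
    ∀ᵐ x ∂(unitSphereMeasure E), ‖x‖ = 1 := by
  rw [unitSphereMeasure, ae_map_iff (measurable_normalize E).aemeasurable
    (measurableSet_eq_fun measurable_norm measurable_const)]
  refine (ProbabilityTheory.cond_absolutelyContinuous (μ := volume)).ae_le ?_
  filter_upwards [compl_mem_ae_iff.2 (measure_singleton (μ := volume) (0 : E))] with y hy
  have : ‖y‖ ≠ 0 := norm_ne_zero_iff.2 hy
  rw [norm_smul, norm_inv, norm_norm, inv_mul_cancel₀ this]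

theorem map_unitSphereMeasure (R : E ≃ₗᵢ[ℝ] E) :
    (unitSphereMeasure E).map R = unitSphereMeasure E := by
  have hR : Measurable R := R.continuous.measurable
  have h2 : (ProbabilityTheory.cond volume (Metric.ball (0 : E) 1)).map R
      = ProbabilityTheory.cond volume (Metric.ball (0 : E) 1) := by
    have h3 := R.measurePreserving.restrict_preimage (s := Metric.ball (0 : E) 1)
      measurableSet_ball
    rw [R.preimage_ball, map_zero] at h3
    unfold ProbabilityTheory.cond
    rw [Measure.map_smul, h3.map_eq]
  unfold unitSphereMeasure
  rw [Measure.map_map hR (measurable_normalize E)]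
  conv_rhs => rw [← h2, Measure.map_map (measurable_normalize E) hR]
  congr 1
  ext y
  simp

theorem integral_comp_unitSphereMeasure (R : E ≃ₗᵢ[ℝ] E) (f : E → ℝ) :
    ∫ x, f (R x) ∂(unitSphereMeasure E) = ∫ x, f x ∂(unitSphereMeasure E) := by
  conv_rhs => rw [← map_unitSphereMeasure E R]
  exact (integral_map_equiv R.toHomeomorph.toMeasurableEquiv f).symm

end SphereMeasure

/-! ### Rotational derivatives and the spherical Laplacian. -/

section Rotation

variable {E : Type*} [NormedAddCommGroup E] [InnerProductSpace ℝ E]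

/-- The generator `v ↦ ⟪a, v⟫ b - ⟪b, v⟫ a` of the rotations in the plane spanned by `a`, `b`. -/
def rotGen (a b : E) : E →L[ℝ] E :=
  (innerSL ℝ a).smulRight b - (innerSL ℝ b).smulRight a

theorem rotGen_apply (a b v : E) : rotGen a b v = inner ℝ a v • b - inner ℝ b v • a := by
  simp [rotGen]

/-- Rotation by the angle with cosine `c` and sine `s` in the plane spanned by the orthonormal
vectors `a`, `b`. -/
def planeRot (a b : E) (c s : ℝ) : E →ₗ[ℝ] E :=
  (ContinuousLinearMap.id ℝ E + ((innerSL ℝ a).smulRight ((c - 1) • a + s • b)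
    + (innerSL ℝ b).smulRight ((c - 1) • b - s • a)) : E →L[ℝ] E)

theorem planeRot_apply (a b v : E) (c s : ℝ) : planeRot a b c s v =
    v + (inner ℝ a v • ((c - 1) • a + s • b) + inner ℝ b v • ((c - 1) • b - s • a)) := by
  simp [planeRot]

theorem norm_planeRot {a b : E} (ha : ‖a‖ = 1) (hb : ‖b‖ = 1) (hab : inner ℝ a b = 0) {c s : ℝ}
    (hcs : c ^ 2 + s ^ 2 = 1) (v : E) : ‖planeRot a b c s v‖ = ‖v‖ := by
  have haa : inner ℝ a a = (1 : ℝ) := by rw [real_inner_self_eq_norm_sq, ha]; norm_num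
  have hbb : inner ℝ b b = (1 : ℝ) := by rw [real_inner_self_eq_norm_sq, hb]; norm_num
  have hba : inner ℝ b a = (0 : ℝ) := by rw [real_inner_comm, hab]
  have h : ‖planeRot a b c s v‖ ^ 2 = ‖v‖ ^ 2 := by
    rw [planeRot_apply, ← real_inner_self_eq_norm_sq, ← real_inner_self_eq_norm_sq]
    simp only [inner_add_left, inner_add_right, inner_sub_left, inner_sub_right, inner_smul_left,
      inner_smul_right, haa, hbb, hab, hba, real_inner_comm a v, real_inner_comm b v, conj_trivial]
    linear_combination ((inner ℝ a v) ^ 2 + (inner ℝ b v) ^ 2) * hcs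
  exact (sq_eq_sq₀ (norm_nonneg _) (norm_nonneg _)).1 h

/-- With `L` and `B` the first and second derivatives of a function at `x`, each summand is its
second derivative along a rotation field. The sum over ordered pairs counts every coordinate plane
twice, and is thus twice the spherical Laplacian. -/
theorem sum_rotGen {ι : Type*} [Fintype ι] [DecidableEq ι] (e : OrthonormalBasis ι ℝ E)
    (B : E →L[ℝ] E →L[ℝ] ℝ) (L : E →L[ℝ] ℝ) (x : E) :
    ∑ i, ∑ j, (B (rotGen (e i) (e j) x) (rotGen (e i) (e j) x)
        + L (rotGen (e i) (e j) (rotGen (e i) (e j) x)))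
      = 2 * (‖x‖ ^ 2 * ∑ i, B (e i) (e i) - B x x - ((Fintype.card ι : ℝ) - 1) * L x) := by
  have hx : ∑ i, inner ℝ (e i) x • e i = x := e.sum_repr' x
  have hn : ∑ i, inner ℝ (e i) x ^ 2 = ‖x‖ ^ 2 := by
    rw [← e.sum_sq_norm_inner_right x]; simp
  have hL : L x = ∑ i, inner ℝ (e i) x * L (e i) := by
    conv_lhs => rw [← hx]
    simp
  have hB : B x x = ∑ i, ∑ j, inner ℝ (e i) x * inner ℝ (e j) x * B (e i) (e j) := by
    conv_lhs => rw [← hx]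
    simp only [map_sum, map_smul, _root_.sum_apply, _root_.smul_apply,
      smul_eq_mul, Finset.mul_sum]
    rw [Finset.sum_comm]
    simp only [mul_assoc, mul_left_comm]
  have hB' : B x x = ∑ i, ∑ j, inner ℝ (e i) x * inner ℝ (e j) x * B (e j) (e i) := by
    rw [hB, Finset.sum_comm]
    simp only [mul_comm (inner ℝ (e _) x) (inner ℝ (e _) x)]
  have h1 : ∑ i, ∑ j, inner ℝ (e i) x ^ 2 * B (e j) (e j) = ‖x‖ ^ 2 * ∑ i, B (e i) (e i) := by
    rw [← hn, Finset.sum_mul_sum]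
  have h2 : ∑ i, ∑ j, inner ℝ (e j) x ^ 2 * B (e i) (e i) = ‖x‖ ^ 2 * ∑ i, B (e i) (e i) := by
    rw [Finset.sum_comm, h1]
  have h3 : ∑ i : ι, ∑ j : ι, inner ℝ (e i) x * L (e i) = (Fintype.card ι : ℝ) * L x := by
    rw [hL]; simp [Finset.mul_sum]
  have h4 : ∑ i : ι, ∑ j : ι, inner ℝ (e j) x * L (e j) = (Fintype.card ι : ℝ) * L x := by
    rw [Finset.sum_comm, h3]
  have h5 : ∑ i, ∑ j, inner ℝ (e i) (e j) * (inner ℝ (e i) x * L (e j)) = L x := by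
    rw [hL]; simp [e.inner_eq_ite]
  have h6 : ∑ i, ∑ j, inner ℝ (e i) (e j) * (inner ℝ (e j) x * L (e i)) = L x := by
    rw [hL]; simp [e.inner_eq_ite]
  have key : ∀ i j, B (rotGen (e i) (e j) x) (rotGen (e i) (e j) x)
        + L (rotGen (e i) (e j) (rotGen (e i) (e j) x))
      = inner ℝ (e i) x ^ 2 * B (e j) (e j) + inner ℝ (e j) x ^ 2 * B (e i) (e i)
        - inner ℝ (e i) x * inner ℝ (e j) x * B (e i) (e j)
        - inner ℝ (e i) x * inner ℝ (e j) x * B (e j) (e i)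
        - inner ℝ (e i) x * L (e i) - inner ℝ (e j) x * L (e j)
        + inner ℝ (e i) (e j) * (inner ℝ (e i) x * L (e j))
        + inner ℝ (e i) (e j) * (inner ℝ (e j) x * L (e i)) := by
    intro i j
    have hi : inner ℝ (e i) (e i) = (1 : ℝ) := by simp
    have hj : inner ℝ (e j) (e j) = (1 : ℝ) := by simp
    simp only [rotGen_apply, map_sub, map_smul, _root_.sub_apply,
      _root_.smul_apply, smul_eq_mul, hi, hj,
      real_inner_comm (e i) (e j)]
    ring
  simp only [key, Finset.sum_add_distrib, Finset.sum_sub_distrib]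
  rw [h1, h2, h3, h4, h5, h6, ← hB, ← hB']
  ring

variable [FiniteDimensional ℝ E] [MeasurableSpace E] [BorelSpace E] [Nontrivial E]

theorem ae_mem_closedBall_unitSphereMeasure :
    ∀ᵐ x ∂(unitSphereMeasure E), x ∈ Metric.closedBall (0 : E) 1 := by
  filter_upwards [ae_norm_eq_one_unitSphereMeasure E] with x hx
  simp [hx]

/-- The mean of `G` composed with a rotation by `θ` does not depend on `θ`; differentiate at `θ =
0`. -/
theorem integral_fderiv_rotGen {a b : E} (ha : ‖a‖ = 1) (hb : ‖b‖ = 1) (hab : inner ℝ a b = 0)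
    {G : E → ℝ} (hG : ContDiff ℝ 1 G) :
    ∫ x, fderiv ℝ G x (rotGen a b x) ∂(unitSphereMeasure E) = 0 := by
  let R : ℝ → E → E := fun θ => planeRot a b (Real.cos θ) (Real.sin θ)
  have hR : ∀ θ x, R θ x = x + (inner ℝ a x • ((Real.cos θ - 1) • a + Real.sin θ • b)
      + inner ℝ b x • ((Real.cos θ - 1) • b - Real.sin θ • a)) := fun θ x => planeRot_apply _ _ _ _ _
  let R' : ℝ → E → E := fun θ x => inner ℝ a x • ((-Real.sin θ) • a + Real.cos θ • b)
      + inner ℝ b x • ((-Real.sin θ) • b - Real.cos θ • a)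
  have hconst : ∀ θ, ∫ x, G (R θ x) ∂(unitSphereMeasure E) = ∫ x, G x ∂(unitSphereMeasure E) := by
    intro θ
    exact integral_comp_unitSphereMeasure E
      (LinearIsometry.toLinearIsometryEquiv ⟨planeRot a b (Real.cos θ) (Real.sin θ),
        norm_planeRot ha hb hab (Real.cos_sq_add_sin_sq θ)⟩ rfl) G
  have hRd : ∀ x θ, HasDerivAt (fun θ => R θ x) (R' θ x) θ := by
    intro x θ
    simp only [hR]
    have hc := (Real.hasDerivAt_cos θ).sub_const 1
    have hs := Real.hasDerivAt_sin θ
    exact ((((hc.smul_const a).add (hs.smul_const b)).const_smul _).add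
      (((hc.smul_const b).sub (hs.smul_const a)).const_smul _)).const_add x
  have hRc : Continuous (fun z : E × ℝ => R z.2 z.1) := by
    simp only [hR]; fun_prop
  have hRc' : Continuous (fun z : E × ℝ => R' z.2 z.1) := by
    simp only [R']; fun_prop
  have hG' : Continuous (fderiv ℝ G) := hG.continuous_fderiv (by norm_num)
  have hd := hasDerivAt_integral_of_ae_mem (isCompact_closedBall (0 : E) 1)
    (ae_mem_closedBall_unitSphereMeasure) (isOpen_univ) (F := fun x θ => G (R θ x))
    (F' := fun x θ => fderiv ℝ G (R θ x) (R' θ x))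
    (fun x _ θ _ => ((hG.differentiable (by norm_num)) (R θ x)).hasFDerivAt.comp_hasDerivAt θ
      (hRd x θ))
    (hG.continuous.comp hRc).continuousOn
    ((hG'.comp hRc).clm_apply hRc').continuousOn (mem_univ (0 : ℝ))
  simp only [hconst] at hd
  have := hd.unique (hasDerivAt_const 0 _)
  rw [← this]
  congr 1
  ext x
  simp [hR, R', rotGen_apply, sub_eq_add_neg]

/-- On spheres centred at the origin, `Δ h - D²h(x, x) - (n - 1) Dh(x)` integrates to zero. -/
theorem integral_unitSphere_laplacian {ι : Type*} [Fintype ι] (e : OrthonormalBasis ι ℝ E)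
    {h : E → ℝ} (hh : ContDiff ℝ 2 h) :
    ∫ x, (fderiv ℝ (fderiv ℝ h) x x x + ((Fintype.card ι : ℝ) - 1) * fderiv ℝ h x x
      - ∑ i, fderiv ℝ (fderiv ℝ h) x (e i) (e i)) ∂(unitSphereMeasure E) = 0 := by
  classical
  have hD : ContDiff ℝ 1 (fderiv ℝ h) := hh.fderiv_right (by norm_num)
  have hDD : Continuous (fderiv ℝ (fderiv ℝ h)) := hD.continuous_fderiv (by norm_num)
  let T : ι → ι → E → ℝ := fun i j x =>
    fderiv ℝ (fderiv ℝ h) x (rotGen (e i) (e j) x) (rotGen (e i) (e j) x)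
      + fderiv ℝ h x (rotGen (e i) (e j) (rotGen (e i) (e j) x))
  have hT : ∀ i j, Continuous (T i j) := by
    intro i j
    have := hD.continuous
    simp only [T]; fun_prop
  have hint : ∀ i j, ∫ x, T i j x ∂(unitSphereMeasure E) = 0 := by
    intro i j
    by_cases hij : i = j
    · subst hij
      simp [T, rotGen_apply]
    -- A second rotational derivative is the first rotational derivative of this function, so its
    -- mean vanishes.
    · have hG : ContDiff ℝ 1 (fun x => fderiv ℝ h x (rotGen (e i) (e j) x)) :=
        hD.clm_apply (rotGen (e i) (e j)).contDiff
      have := integral_fderiv_rotGen (a := e i) (b := e j) (by simp) (by simp)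
        (by simp [e.inner_eq_ite, hij]) hG
      rw [← this]
      congr 1
      ext x
      have h1 := ((hD.differentiable (by norm_num)) x).hasFDerivAt.clm_apply
        (rotGen (e i) (e j)).hasFDerivAt
      rw [h1.fderiv]
      simp [T, add_comm]
  have hsum : ∫ x, ∑ i, ∑ j, T i j x ∂(unitSphereMeasure E) = 0 := by
    have hi : ∀ i j, Integrable (T i j) (unitSphereMeasure E) := fun i j =>
      (hT i j).continuousOn.integrable_of_ae_mem (isCompact_closedBall (0 : E) 1)
        ae_mem_closedBall_unitSphereMeasure
    rw [integral_finsetSum _ fun i _ => integrable_finsetSum _ fun j _ => hi i j]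
    refine Finset.sum_eq_zero fun i _ => ?_
    rw [integral_finsetSum _ fun j _ => hi i j]
    exact Finset.sum_eq_zero fun j _ => hint i j
  have h2 : (fun x => ∑ i, ∑ j, T i j x) =ᵐ[unitSphereMeasure E]
      fun x => (-2) * (fderiv ℝ (fderiv ℝ h) x x x + ((Fintype.card ι : ℝ) - 1) * fderiv ℝ h x x
      - ∑ i, fderiv ℝ (fderiv ℝ h) x (e i) (e i)) := by
    filter_upwards [ae_norm_eq_one_unitSphereMeasure E] with x hx
    simp only [T]
    rw [sum_rotGen, hx]
    ring
  rw [integral_congr_ae h2, integral_const_mul] at hsum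
  linarith

end Rotation


/-! ### Functions of class `C²` on a half-open time strip. -/

section Strip

theorem strip_mem_nhds {E : Type*} [TopologicalSpace E] {T : ℝ} {z : E × ℝ} (hz : z ∈ (univ : Set E) ×ˢ Ioo 0 T) :
    (univ : Set E) ×ˢ Ico 0 T ∈ 𝓝 z :=
  mem_of_superset ((isOpen_univ.prod isOpen_Ioo).mem_nhds hz) (prod_mono_right Ioo_subset_Ico_self)

variable {E : Type*} [NormedAddCommGroup E] [NormedSpace ℝ E]

/-- `w` is of class `C²` on the strip `E × [0, T)`, with first derivative `D` up to `t = 0` and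
second derivative `D2` in the interior. -/
structure IsC2OnStrip (T : ℝ) (w : E × ℝ → ℝ) (D : E × ℝ → E × ℝ →L[ℝ] ℝ)
    (D2 : E × ℝ → E × ℝ →L[ℝ] E × ℝ →L[ℝ] ℝ) : Prop where
  cont : ContinuousOn w (univ ×ˢ Ico 0 T)
  contD : ContinuousOn D (univ ×ˢ Ico 0 T)
  contD2 : ContinuousOn D2 (univ ×ˢ Ioo 0 T)
  hasD : ∀ z ∈ (univ : Set E) ×ˢ Ico 0 T, HasFDerivWithinAt w (D z) (univ ×ˢ Ico 0 T) z
  hasD2 : ∀ z ∈ (univ : Set E) ×ˢ Ioo 0 T, HasFDerivAt D (D2 z) z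
  symm : ∀ z ∈ (univ : Set E) ×ˢ Ioo 0 T, ∀ a b, D2 z a b = D2 z b a

theorem IsC2OnStrip.of_contDiffOn {T : ℝ} {w : E × ℝ → ℝ}
    (hw : ContDiffOn ℝ 2 w (univ ×ˢ Ico 0 T)) :
    IsC2OnStrip T w (fderivWithin ℝ w (univ ×ˢ Ico 0 T))
      (fderiv ℝ (fderivWithin ℝ w (univ ×ˢ Ico 0 T))) := by
  have hu : UniqueDiffOn ℝ ((univ : Set E) ×ˢ Ico (0 : ℝ) T) :=
    uniqueDiffOn_univ.prod (uniqueDiffOn_Ico 0 T)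
  have hO : IsOpen ((univ : Set E) ×ˢ Ioo (0 : ℝ) T) := isOpen_univ.prod isOpen_Ioo
  have hD : ContDiffOn ℝ 1 (fderivWithin ℝ w (univ ×ˢ Ico 0 T)) (univ ×ˢ Ico 0 T) :=
    hw.fderivWithin hu (by norm_num)
  have hD' := hD.mono (prod_mono_right (s := (univ : Set E)) (Ioo_subset_Ico_self (a := 0) (b := T)))
  refine ⟨hw.continuousOn, hD.continuousOn, hD'.continuousOn_fderiv_of_isOpen hO (by norm_num),
    fun z hz => ((hw.differentiableOn (by norm_num)) z hz).hasFDerivWithinAt,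
    fun z hz => (((hD'.differentiableOn (by norm_num)) z hz).differentiableAt
      (hO.mem_nhds hz)).hasFDerivAt, fun z hz a b => ?_⟩
  have hev : fderivWithin ℝ w (univ ×ˢ Ico 0 T) =ᶠ[𝓝 z] fderiv ℝ w := by
    filter_upwards [hO.mem_nhds hz] with y hy using fderivWithin_of_mem_nhds (strip_mem_nhds hy)
  rw [hev.fderiv_eq]
  exact ((hw.contDiffAt (strip_mem_nhds hz)).isSymmSndFDerivAt (by simp)) a b

namespace IsC2OnStrip

variable {T : ℝ} {w : E × ℝ → ℝ} {D : E × ℝ → E × ℝ →L[ℝ] ℝ}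
    {D2 : E × ℝ → E × ℝ →L[ℝ] E × ℝ →L[ℝ] ℝ}

theorem hasFDerivAt (h : IsC2OnStrip T w D D2) {z : E × ℝ} (hz : z ∈ (univ : Set E) ×ˢ Ioo 0 T) :
    HasFDerivAt w (D z) z :=
  (h.hasD z (prod_mono_right Ioo_subset_Ico_self hz)).hasFDerivAt (strip_mem_nhds hz)

section Slice

variable {E' : Type*} [NormedAddCommGroup E'] [NormedSpace ℝ E'] (M : E' →L[ℝ] E) (x₀ : E)
  {t : ℝ}

theorem hasFDerivAt_slice (h : IsC2OnStrip T w D D2) (ht : t ∈ Ioo 0 T) (x : E') :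
    HasFDerivAt (fun x => w (x₀ + M x, t))
      ((D (x₀ + M x, t)).comp (M.prod (0 : E' →L[ℝ] ℝ))) x := by
  have h1 : HasFDerivAt (fun x => (x₀ + M x, t)) (M.prod (0 : E' →L[ℝ] ℝ)) x :=
    (M.hasFDerivAt.const_add x₀).prodMk (hasFDerivAt_const t x)
  exact (h.hasFDerivAt (z := (x₀ + M x, t)) ⟨mem_univ _, ht⟩).comp x h1

theorem fderiv_slice (h : IsC2OnStrip T w D D2) (ht : t ∈ Ioo 0 T) :
    fderiv ℝ (fun x => w (x₀ + M x, t))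
      = fun x => (D (x₀ + M x, t)).comp (M.prod (0 : E' →L[ℝ] ℝ)) :=
  funext fun x => (h.hasFDerivAt_slice M x₀ ht x).fderiv

theorem hasFDerivAt_fderiv_slice (h : IsC2OnStrip T w D D2) (ht : t ∈ Ioo 0 T) (x : E') :
    HasFDerivAt (fderiv ℝ (fun x => w (x₀ + M x, t)))
      ((((ContinuousLinearMap.compL ℝ E' (E × ℝ) ℝ).flip (M.prod (0 : E' →L[ℝ] ℝ))).comp
        (D2 (x₀ + M x, t))).comp (M.prod (0 : E' →L[ℝ] ℝ))) x := by
  rw [h.fderiv_slice M x₀ ht]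
  have h1 : HasFDerivAt (fun x => (x₀ + M x, t)) (M.prod (0 : E' →L[ℝ] ℝ)) x :=
    (M.hasFDerivAt.const_add x₀).prodMk (hasFDerivAt_const t x)
  have h2 := (h.hasD2 (x₀ + M x, t) ⟨mem_univ _, ht⟩).comp x h1
  exact ((ContinuousLinearMap.compL ℝ E' (E × ℝ) ℝ).flip
    (M.prod (0 : E' →L[ℝ] ℝ))).hasFDerivAt.comp x h2

theorem fderiv_slice_apply (h : IsC2OnStrip T w D D2) (ht : t ∈ Ioo 0 T) (x v : E') :
    fderiv ℝ (fun x => w (x₀ + M x, t)) x v = D (x₀ + M x, t) (M v, 0) := by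
  rw [h.fderiv_slice M x₀ ht]; rfl

theorem fderiv_fderiv_slice_apply (h : IsC2OnStrip T w D D2) (ht : t ∈ Ioo 0 T) (x v v' : E') :
    fderiv ℝ (fderiv ℝ (fun x => w (x₀ + M x, t))) x v v'
      = D2 (x₀ + M x, t) (M v, 0) (M v', 0) := by
  rw [(h.hasFDerivAt_fderiv_slice M x₀ ht x).fderiv]; rfl

theorem contDiff_slice (h : IsC2OnStrip T w D D2) (ht : t ∈ Ioo 0 T) :
    ContDiff ℝ 2 (fun x => w (x₀ + M x, t)) := by
  rw [show (2 : WithTop ℕ∞) = 1 + 1 by norm_num, contDiff_succ_iff_fderiv]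
  refine ⟨fun x => (h.hasFDerivAt_slice M x₀ ht x).differentiableAt, by simp, ?_⟩
  rw [contDiff_one_iff_fderiv]
  refine ⟨fun x => (h.hasFDerivAt_fderiv_slice M x₀ ht x).differentiableAt, ?_⟩
  have h1 : Continuous fun x => D2 (x₀ + M x, t) :=
    h.contD2.comp_continuous (by fun_prop) fun x => ⟨mem_univ _, ht⟩
  rw [show fderiv ℝ (fderiv ℝ fun x => w (x₀ + M x, t)) = _ from
    funext fun x => (h.hasFDerivAt_fderiv_slice M x₀ ht x).fderiv]
  exact (continuous_const.clm_comp h1).clm_comp continuous_const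

end Slice

theorem iteratedDeriv_two_time (h : IsC2OnStrip T w D D2) (x : E) {t : ℝ} (ht : t ∈ Ioo 0 T) :
    iteratedDeriv 2 (fun s => w (x, s)) t = D2 (x, t) (0, 1) (0, 1) := by
  have hp : ∀ s, HasDerivAt (fun s : ℝ => (x, s)) ((0 : E), (1 : ℝ)) s := fun s =>
    (hasDerivAt_const s x).prodMk (hasDerivAt_id s)
  have h1 : deriv (fun s => w (x, s)) =ᶠ[𝓝 t] fun s => D (x, s) (0, 1) := by
    filter_upwards [isOpen_Ioo.mem_nhds ht] with s hs
    exact ((h.hasFDerivAt (z := (x, s)) ⟨mem_univ _, hs⟩).comp_hasDerivAt s (hp s)).deriv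
  rw [iteratedDeriv_succ, iteratedDeriv_one, h1.deriv_eq]
  have h2 := (h.hasD2 (x, t) ⟨mem_univ _, ht⟩).comp_hasDerivAt t (hp t)
  have h3 := h2.clm_apply (hasDerivAt_const t ((0 : E), (1 : ℝ)))
  simpa using h3.deriv

theorem initial_values (hT : 0 < T) (h : IsC2OnStrip T w D D2) (h0 : ∀ x, w (x, 0) = 0)
    {γ : ℝ} {x : E} (h1 : HasDerivWithinAt (fun s => w (x, s)) γ (Ici 0) 0) (v : E) (s : ℝ) :
    D (x, 0) (v, s) = s * γ := by
  have hz : (x, (0 : ℝ)) ∈ (univ : Set E) ×ˢ Ico 0 T := ⟨mem_univ _, by simp [hT]⟩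
  have hD := h.hasD _ hz
  -- Spatial derivatives at `t = 0` vanish because `w` vanishes on the whole initial slice.
  have hv : D (x, 0) (v, 0) = 0 := by
    have h2 : HasDerivAt (fun r : ℝ => (x + r • v, (0 : ℝ))) (v, 0) 0 := by
      have := (((hasDerivAt_id (0 : ℝ)).smul_const v).const_add x).prodMk
        (hasDerivAt_const (0 : ℝ) (0 : ℝ))
      simpa using this
    have h3 := HasFDerivWithinAt.comp_hasDerivWithinAt (t := (univ : Set E) ×ˢ Ico 0 T)
      (s := univ) (f := fun r : ℝ => (x + r • v, (0 : ℝ))) (l := w) (0 : ℝ) (l' := D (x, 0))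
      (by simpa using hD) h2.hasDerivWithinAt (fun r _ => ⟨mem_univ _, by simp [hT]⟩)
    rw [hasDerivWithinAt_univ] at h3
    have h4 : w ∘ (fun r : ℝ => (x + r • v, (0 : ℝ))) = fun _ => 0 := funext fun r => h0 _
    rw [h4] at h3
    exact h3.unique (hasDerivAt_const _ _)
  have hs : D (x, 0) (0, 1) = γ := by
    have h2 : HasDerivAt (fun r : ℝ => (x, r)) ((0 : E), (1 : ℝ)) 0 :=
      (hasDerivAt_const _ x).prodMk (hasDerivAt_id _)
    have h3 := HasFDerivWithinAt.comp_hasDerivWithinAt (t := (univ : Set E) ×ˢ Ico 0 T)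
      (s := Ico 0 T) (f := fun r : ℝ => (x, r)) (l := w) (0 : ℝ) (l' := D (x, 0))
      hD h2.hasDerivWithinAt (fun r hr => ⟨mem_univ _, hr⟩)
    exact (uniqueDiffOn_Ico 0 T 0 ⟨le_rfl, hT⟩).eq_deriv _ h3 (h1.mono Ico_subset_Ici_self)
  have : ((v, s) : E × ℝ) = (v, 0) + s • (0, 1) := by simp
  rw [this, map_add, map_smul, hv, hs]
  simp

end IsC2OnStrip

end Strip


/-! ### Continuity of the derivatives along spheres. -/

section Composition

variable {E E' : Type*} [NormedAddCommGroup E] [NormedSpace ℝ E] [NormedAddCommGroup E']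
  [NormedSpace ℝ E'] {T : ℝ} {w : E × ℝ → ℝ}
  {D : E × ℝ → E × ℝ →L[ℝ] ℝ} {D2 : E × ℝ → E × ℝ →L[ℝ] E × ℝ →L[ℝ] ℝ}

namespace IsC2OnStrip

theorem continuous_comp (h : IsC2OnStrip T w D D2) (P : E' →L[ℝ] E) (x₀ : E) {t r : ℝ}
    (ht : t ∈ Ico 0 T) : Continuous (fun x => w (x₀ + r • P x, t)) :=
  h.cont.comp_continuous (by fun_prop) fun _ => ⟨mem_univ _, ht⟩

theorem continuous_deriv_comp (h : IsC2OnStrip T w D D2) (P : E' →L[ℝ] E) (x₀ : E) {t r : ℝ}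
    (ht : t ∈ Ico 0 T) {v : E' → E × ℝ} (hv : Continuous v) :
    Continuous (fun x => D (x₀ + r • P x, t) (v x)) :=
  (h.contD.comp_continuous (by fun_prop) fun _ => ⟨mem_univ _, ht⟩).clm_apply hv

theorem continuous_deriv2_comp (h : IsC2OnStrip T w D D2) (P : E' →L[ℝ] E) (x₀ : E) {t r : ℝ}
    (ht : t ∈ Ioo 0 T) {v v' : E' → E × ℝ} (hv : Continuous v) (hv' : Continuous v') :
    Continuous (fun x => D2 (x₀ + r • P x, t) (v x) (v' x)) :=
  ((h.contD2.comp_continuous (by fun_prop) fun _ => ⟨mem_univ _, ht⟩).clm_apply hv).clm_apply hv'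

end IsC2OnStrip

end Composition

/-! ### Averages over spheres whose radius and time move with a parameter. -/

section Means

variable {E E' : Type*} [NormedAddCommGroup E] [NormedSpace ℝ E] [NormedAddCommGroup E']
  [NormedSpace ℝ E'] [MeasurableSpace E'] [BorelSpace E'] {T : ℝ} {w : E × ℝ → ℝ}
  {D : E × ℝ → E × ℝ →L[ℝ] ℝ} {D2 : E × ℝ → E × ℝ →L[ℝ] E × ℝ →L[ℝ] ℝ}

namespace IsC2OnStrip

section Paths

variable (P : E' →L[ℝ] E) (x₀ : E) {μ : Measure E'} [IsFiniteMeasure μ] {K : Set E'}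
  (hK : IsCompact K) (hμ : ∀ᵐ x ∂μ, x ∈ K) {I J : Set ℝ} {ρ τ : ℝ → ℝ} {ρ' τ' : ℝ}

include hK hμ

theorem continuousOn_mean (h : IsC2OnStrip T w D D2) (hJ : IsCompact J) (hρ : Continuous ρ)
    (hτ : Continuous τ) (hJT : MapsTo τ J (Ico 0 T)) :
    ContinuousOn (fun s => ∫ x, w (x₀ + ρ s • P x, τ s) ∂μ) J := by
  refine continuousOn_integral_of_ae_mem hK hμ hJ (F := fun x s => w (x₀ + ρ s • P x, τ s)) ?_
  exact h.cont.comp (f := fun z : E' × ℝ => (x₀ + ρ z.2 • P z.1, τ z.2)) (by fun_prop)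
    fun z hz => ⟨mem_univ _, hJT hz.2⟩

theorem continuousOn_mean_deriv (h : IsC2OnStrip T w D D2) (hJ : IsCompact J) (hρ : Continuous ρ)
    (hτ : Continuous τ) (hJT : MapsTo τ J (Ico 0 T)) {v : E' → E × ℝ} (hv : Continuous v) :
    ContinuousOn (fun s => ∫ x, D (x₀ + ρ s • P x, τ s) (v x) ∂μ) J := by
  refine continuousOn_integral_of_ae_mem hK hμ hJ
    (F := fun x s => D (x₀ + ρ s • P x, τ s) (v x)) ?_
  refine ContinuousOn.clm_apply (f := fun z : E' × ℝ => D (x₀ + ρ z.2 • P z.1, τ z.2)) ?_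
    (by fun_prop)
  exact h.contD.comp (f := fun z : E' × ℝ => (x₀ + ρ z.2 • P z.1, τ z.2)) (by fun_prop)
    fun z hz => ⟨mem_univ _, hJT hz.2⟩

theorem hasDerivAt_mean (h : IsC2OnStrip T w D D2) (hI : IsOpen I)
    (hρ : ∀ s, HasDerivAt ρ ρ' s) (hτ : ∀ s, HasDerivAt τ τ' s) (hIT : MapsTo τ I (Ioo 0 T))
    {s : ℝ} (hs : s ∈ I) :
    HasDerivAt (fun s => ∫ x, w (x₀ + ρ s • P x, τ s) ∂μ)
      (∫ x, D (x₀ + ρ s • P x, τ s) (ρ' • P x, τ') ∂μ) s := by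
  have hρc : Continuous ρ := continuous_iff_continuousAt.2 fun s => (hρ s).continuousAt
  have hτc : Continuous τ := continuous_iff_continuousAt.2 fun s => (hτ s).continuousAt
  have hm : MapsTo (fun z : E' × ℝ => (x₀ + ρ z.2 • P z.1, τ z.2)) (K ×ˢ I)
    ((univ : Set E) ×ˢ Ioo 0 T) := fun z hz => ⟨mem_univ _, hIT hz.2⟩
  have hm' := hm.mono_right (prod_mono_right Ioo_subset_Ico_self)
  have hc : Continuous (fun z : E' × ℝ => (x₀ + ρ z.2 • P z.1, τ z.2)) := by fun_prop
  refine hasDerivAt_integral_of_ae_mem hK hμ hI (F := fun x s => w (x₀ + ρ s • P x, τ s))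
    (F' := fun x s => D (x₀ + ρ s • P x, τ s) (ρ' • P x, τ')) (fun x _ s hs => ?_) ?_ ?_ hs
  · exact (h.hasFDerivAt (z := (x₀ + ρ s • P x, τ s)) ⟨mem_univ _, hIT hs⟩).comp_hasDerivAt s
      ((((hρ s).smul_const (P x)).const_add x₀).prodMk (hτ s))
  · exact h.cont.comp hc.continuousOn hm'
  · exact (h.contD.comp hc.continuousOn hm').clm_apply (by fun_prop)

theorem hasDerivAt_mean_deriv (h : IsC2OnStrip T w D D2) (hI : IsOpen I)
    (hρ : ∀ s, HasDerivAt ρ ρ' s) (hτ : ∀ s, HasDerivAt τ τ' s) (hIT : MapsTo τ I (Ioo 0 T))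
    {v : E' → E × ℝ} (hv : Continuous v) {s : ℝ} (hs : s ∈ I) :
    HasDerivAt (fun s => ∫ x, D (x₀ + ρ s • P x, τ s) (v x) ∂μ)
      (∫ x, D2 (x₀ + ρ s • P x, τ s) (ρ' • P x, τ') (v x) ∂μ) s := by
  have hρc : Continuous ρ := continuous_iff_continuousAt.2 fun s => (hρ s).continuousAt
  have hτc : Continuous τ := continuous_iff_continuousAt.2 fun s => (hτ s).continuousAt
  have hm : MapsTo (fun z : E' × ℝ => (x₀ + ρ z.2 • P z.1, τ z.2)) (K ×ˢ I)
    ((univ : Set E) ×ˢ Ioo 0 T) := fun z hz => ⟨mem_univ _, hIT hz.2⟩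
  have hm' := hm.mono_right (prod_mono_right Ioo_subset_Ico_self)
  have hc : Continuous (fun z : E' × ℝ => (x₀ + ρ z.2 • P z.1, τ z.2)) := by fun_prop
  refine hasDerivAt_integral_of_ae_mem hK hμ hI
    (F := fun x s => D (x₀ + ρ s • P x, τ s) (v x))
    (F' := fun x s => D2 (x₀ + ρ s • P x, τ s) (ρ' • P x, τ') (v x)) (fun x _ s hs => ?_) ?_ ?_ hs
  · have h1 := (h.hasD2 (x₀ + ρ s • P x, τ s) ⟨mem_univ _, hIT hs⟩).comp_hasDerivAt s
      ((((hρ s).smul_const (P x)).const_add x₀).prodMk (hτ s))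
    simpa using h1.clm_apply (hasDerivAt_const s (v x))
  · exact (h.contD.comp hc.continuousOn hm').clm_apply (by fun_prop)
  · exact ((h.contD2.comp hc.continuousOn hm).clm_apply (by fun_prop)).clm_apply (by fun_prop)

end Paths

end IsC2OnStrip

end Means

/-! ### The Laplacian on spheres, and positivity by Kirchhoff's formula. -/

section SphericalMeans

variable {E E' : Type*} [NormedAddCommGroup E] [NormedSpace ℝ E]
  [NormedAddCommGroup E'] [InnerProductSpace ℝ E'] [FiniteDimensional ℝ E'] [MeasurableSpace E']
  [BorelSpace E'] [Nontrivial E'] {T : ℝ} {w : E × ℝ → ℝ}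
  {D : E × ℝ → E × ℝ →L[ℝ] ℝ} {D2 : E × ℝ → E × ℝ →L[ℝ] E × ℝ →L[ℝ] ℝ}

namespace IsC2OnStrip

theorem integral_sphere_laplacian (h : IsC2OnStrip T w D D2) {ι : Type*} [Fintype ι]
    (e : OrthonormalBasis ι ℝ E') (P : E' →L[ℝ] E) (x₀ : E) {t r : ℝ} (ht : t ∈ Ioo 0 T)
    (hr : r ≠ 0) :
    ∫ x, (r * D2 (x₀ + r • P x, t) (P x, 0) (P x, 0)
      + ((Fintype.card ι : ℝ) - 1) * D (x₀ + r • P x, t) (P x, 0)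
      - r * ∑ i, D2 (x₀ + r • P x, t) (P (e i), 0) (P (e i), 0)) ∂(unitSphereMeasure E') = 0 := by
  have h1 := integral_unitSphere_laplacian e (h.contDiff_slice (r • P) x₀ ht)
  simp only [h.fderiv_slice_apply (r • P) x₀ ht, h.fderiv_fderiv_slice_apply (r • P) x₀ ht] at h1
  have h2 : ∀ v : E', ((r • P v, 0) : E × ℝ) = r • (P v, 0) := fun v => by simp
  simp only [_root_.smul_apply, h2, map_smul, smul_eq_mul] at h1
  rw [← mul_right_inj' hr, mul_zero, ← integral_const_mul]
  refine Eq.trans ?_ h1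
  congr 1
  ext x
  simp only [Finset.mul_sum, mul_sub, mul_add]
  ring_nf

end IsC2OnStrip

theorem Continuous.integrable_unitSphereMeasure {f : E' → ℝ} (hf : Continuous f) :
    Integrable f (unitSphereMeasure E') :=
  hf.continuousOn.integrable_of_ae_mem (isCompact_closedBall (0 : E') 1)
    ae_mem_closedBall_unitSphereMeasure

namespace IsC2OnStrip

/-- Nonnegativity of solutions of `w_tt - Δ w = F ≥ 0` with data `0`, `γ ≥ 0`, by Kirchhoff's
formula. The map `P` projects three-dimensional space onto `E`. -/
theorem nonneg_of_wave (h : IsC2OnStrip T w D D2) {ι : Type*} [Fintype ι]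
    (hι : Fintype.card ι = 3) (e : OrthonormalBasis ι ℝ E') (P : E' →L[ℝ] E)
    (heq : ∀ z ∈ (univ : Set E) ×ˢ Ioo 0 T,
      ∑ i, D2 z (P (e i), 0) (P (e i), 0) ≤ D2 z (0, 1) (0, 1))
    {γ : E → ℝ} (hγ : ∀ x, 0 ≤ γ x) (h0 : ∀ x, w (x, 0) = 0)
    (h1 : ∀ x v s, D (x, 0) (v, s) = s * γ x) (x₀ : E) {t₀ : ℝ} (ht₀ : t₀ ∈ Ioo 0 T) :
    0 ≤ w (x₀, t₀) := by
  have hK := isCompact_closedBall (0 : E') 1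
  have hμ := ae_mem_closedBall_unitSphereMeasure (E := E')
  -- Kirchhoff's expression on the sphere of radius `s` of the backward light cone. It equals `w
  -- (x₀, t₀)` at `s = 0` and `t₀` times a mean of `γ` at `s = t₀`; its derivative is `s` times the
  -- mean of `Δw - w_tt`, hence nonpositive.
  let k : ℝ → ℝ := fun s => ∫ x, w (x₀ + s • P x, t₀ - s) ∂(unitSphereMeasure E')
    + s * ∫ x, D (x₀ + s • P x, t₀ - s) (P x, 1) ∂(unitSphereMeasure E')
  have hm : MapsTo (fun s => t₀ - s) (Icc 0 t₀) (Ico 0 T) := fun s hs =>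
    ⟨by linarith [hs.2], by linarith [hs.1, ht₀.2]⟩
  have hm' : MapsTo (fun s => t₀ - s) (Ioo 0 t₀) (Ioo 0 T) := fun s hs =>
    ⟨by linarith [hs.2], by linarith [hs.1, ht₀.2]⟩
  have hc : ContinuousOn k (Icc 0 t₀) :=
    (h.continuousOn_mean P x₀ hK hμ isCompact_Icc continuous_id (by fun_prop) hm).add
      (continuousOn_id.mul (h.continuousOn_mean_deriv P x₀ hK hμ isCompact_Icc continuous_id
        (by fun_prop) hm (v := fun x => (P x, 1)) (by fun_prop)))
  have hd : ∀ s ∈ Ioo 0 t₀, HasDerivAt k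
      (∫ x, D (x₀ + s • P x, t₀ - s) ((1 : ℝ) • P x, -1) ∂(unitSphereMeasure E')
      + (1 * ∫ x, D (x₀ + s • P x, t₀ - s) (P x, 1) ∂(unitSphereMeasure E')
        + s * ∫ x, D2 (x₀ + s • P x, t₀ - s) ((1 : ℝ) • P x, -1) (P x, 1)
          ∂(unitSphereMeasure E'))) s := by
    intro s hs
    have hτ : ∀ s, HasDerivAt (fun s => t₀ - s) (-1) s := fun s => by
      simpa using (hasDerivAt_id s).const_sub t₀
    exact (h.hasDerivAt_mean P x₀ hK hμ isOpen_Ioo hasDerivAt_id hτ hm' hs).add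
      ((hasDerivAt_id s).mul (h.hasDerivAt_mean_deriv P x₀ hK hμ isOpen_Ioo hasDerivAt_id hτ hm'
        (v := fun x => (P x, 1)) (by fun_prop) hs))
  have hanti : AntitoneOn k (Icc 0 t₀) := by
    refine antitoneOn_of_deriv_nonpos (convex_Icc _ _) hc ?_ ?_
    · rw [interior_Icc]
      exact fun s hs => (hd s hs).differentiableAt.differentiableWithinAt
    · rw [interior_Icc]
      intro s hs
      rw [(hd s hs).deriv]
      have hst : t₀ - s ∈ Ioo 0 T := hm' hs
      have hst' : t₀ - s ∈ Ico 0 T := Ioo_subset_Ico_self hst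
      have i1 := (h.continuous_deriv_comp P x₀ (r := s) hst'
        (v := fun x => ((1 : ℝ) • P x, -1)) (by fun_prop)).integrable_unitSphereMeasure
      have i2 := (h.continuous_deriv_comp P x₀ (r := s) hst'
        (v := fun x => (P x, 1)) (by fun_prop)).integrable_unitSphereMeasure
      have i3 := (h.continuous_deriv2_comp P x₀ (r := s) hst
        (v := fun x => ((1 : ℝ) • P x, -1)) (v' := fun x => (P x, 1))
        (by fun_prop) (by fun_prop)).integrable_unitSphereMeasure
      have i23 : Integrable (fun x => D (x₀ + s • P x, t₀ - s) (P x, 1)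
          + s * D2 (x₀ + s • P x, t₀ - s) ((1 : ℝ) • P x, -1) (P x, 1)) (unitSphereMeasure E') :=
        i2.add (i3.const_mul s)
      rw [one_mul, ← integral_const_mul, ← integral_add i2 (i3.const_mul s), ← integral_add i1 i23,
        ← h.integral_sphere_laplacian e P x₀ hst hs.1.ne']
      -- The zero on the right has become the spherical Laplacian identity; with `card ι - 1 = 2`
      -- its first-order term is the one in `k'`, so the integrands compare pointwise by the wave
      -- inequality.
      refine integral_mono (i1.add i23) ?_ fun x => ?_
      · refine Continuous.integrable_unitSphereMeasure ?_
        have c1 := h.continuous_deriv2_comp P x₀ (r := s) hst (v := fun x => (P x, 0))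
          (v' := fun x => (P x, 0)) (by fun_prop) (by fun_prop)
        have c2 := h.continuous_deriv_comp P x₀ (r := s) hst' (v := fun x => (P x, 0))
          (by fun_prop)
        exact ((c1.const_mul s).add (c2.const_mul _)).sub (Continuous.const_mul
          (continuous_finsetSum _ fun i _ => h.continuous_deriv2_comp P x₀ (r := s) hst
            (v := fun _ => (P (e i), 0)) (v' := fun _ => (P (e i), 0))
            (by fun_prop) (by fun_prop)) s)
      · have hz := heq (x₀ + s • P x, t₀ - s) ⟨mem_univ _, hst⟩
        have hsy := h.symm (x₀ + s • P x, t₀ - s) ⟨mem_univ _, hst⟩ (P x, 0) (0, 1)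
        have v1 : (((1 : ℝ) • P x, -1) : E × ℝ) = (P x, 0) - (0, 1) := by simp
        have v2 : ((P x, 1) : E × ℝ) = (P x, 0) + (0, 1) := by simp
        simp only [v1, v2, map_sub, map_add, _root_.sub_apply, hι]
        rw [hsy]
        have := mul_le_mul_of_nonneg_left hz hs.1.le
        push_cast
        linarith
  have hle := hanti (left_mem_Icc.2 ht₀.1.le) (right_mem_Icc.2 ht₀.1.le) ht₀.1.le
  have hk0 : k 0 = w (x₀, t₀) := by simp [k]
  have hk1 : 0 ≤ k t₀ := by
    simp only [k, sub_self, h0, h1, integral_zero, zero_add]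
    exact mul_nonneg ht₀.1.le (integral_nonneg fun x => by simpa using hγ _)
  linarith

end IsC2OnStrip

end SphericalMeans


/-! ### Spherical means in characteristic coordinates. -/

section Characteristic

variable {E : Type*} [NormedAddCommGroup E] [InnerProductSpace ℝ E] [FiniteDimensional ℝ E]
  [MeasurableSpace E] [BorelSpace E]

/-- `r ^ m` times the mean of `w` over the sphere of radius `r` about `x₀` at time `t`, in the
characteristic coordinates `a = t + r`, `b = t - r`. -/
def charMean (m : ℝ) (x₀ : E) (w : E × ℝ → ℝ) (a b : ℝ) : ℝ :=
  ((a - b) / 2) ^ m * ∫ x, w (x₀ + ((a - b) / 2) • x, (a + b) / 2) ∂(unitSphereMeasure E)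

/-- The derivative of `charMean` in `a`. -/
def charMeanDeriv (m : ℝ) (x₀ : E) (w : E × ℝ → ℝ) (D : E × ℝ → E × ℝ →L[ℝ] ℝ) (a b : ℝ) : ℝ :=
  1 / 2 * m * ((a - b) / 2) ^ (m - 1)
      * ∫ x, w (x₀ + ((a - b) / 2) • x, (a + b) / 2) ∂(unitSphereMeasure E)
    + ((a - b) / 2) ^ m
      * ∫ x, D (x₀ + ((a - b) / 2) • x, (a + b) / 2) ((1 / 2 : ℝ) • x, 1 / 2) ∂(unitSphereMeasure E)

theorem rpow_integral_le_integral_rpow {α : Type*} [MeasurableSpace α] {μ : Measure α}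
    [IsProbabilityMeasure μ] {p : ℝ} (hp : 1 ≤ p) {f : α → ℝ} (hf : ∀ x, 0 ≤ f x)
    (hi : Integrable f μ) (hi' : Integrable (fun x => f x ^ p) μ) :
    (∫ x, f x ∂μ) ^ p ≤ ∫ x, f x ^ p ∂μ :=
  ConvexOn.map_integral_le (convexOn_rpow hp)
    (Real.continuous_rpow_const (by linarith)).continuousOn isClosed_Ici
    (Eventually.of_forall fun x => hf x) hi hi'

variable {T : ℝ} {w : E × ℝ → ℝ}
  {D : E × ℝ → E × ℝ →L[ℝ] ℝ} {D2 : E × ℝ → E × ℝ →L[ℝ] E × ℝ →L[ℝ] ℝ} {m : ℝ} {x₀ : E}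

theorem charMean_nonneg (hw : ∀ z ∈ (univ : Set E) ×ˢ Ico 0 T, 0 ≤ w z) {a b : ℝ} (hba : b ≤ a)
    (h0 : 0 ≤ a + b) (hT : a + b < 2 * T) : 0 ≤ charMean m x₀ w a b :=
  mul_nonneg (Real.rpow_nonneg (by linarith) _)
    (integral_nonneg fun x => hw _ ⟨mem_univ _, by constructor <;> linarith⟩)

theorem charMean_self (hm : 0 < m) (b : ℝ) : charMean m x₀ w b b = 0 := by
  simp [charMean, Real.zero_rpow hm.ne']

theorem charMeanDeriv_initial {γ : E → ℝ} (h0 : ∀ x, w (x, 0) = 0)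
    (h1 : ∀ x v s, D (x, 0) (v, s) = s * γ x) (a : ℝ) :
    charMeanDeriv m x₀ w D a (-a)
      = a ^ m * (1 / 2 * ∫ x, γ (x₀ + a • x) ∂(unitSphereMeasure E)) := by
  simp [charMeanDeriv, h0, h1, integral_const_mul]

variable [Nontrivial E]

theorem hasDerivAt_half_sub_left (b a : ℝ) : HasDerivAt (fun a : ℝ => (a - b) / 2) (1 / 2) a :=
  ((hasDerivAt_id a).sub_const b).div_const 2

theorem hasDerivAt_half_sub_right (a b : ℝ) : HasDerivAt (fun b : ℝ => (a - b) / 2) (-(1 / 2)) b := by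
  simpa [neg_div] using ((hasDerivAt_id b).const_sub a).div_const 2

theorem hasDerivAt_half_add_left (b a : ℝ) : HasDerivAt (fun a : ℝ => (a + b) / 2) (1 / 2) a :=
  ((hasDerivAt_id a).add_const b).div_const 2

theorem hasDerivAt_half_add_right (a b : ℝ) : HasDerivAt (fun b : ℝ => (a + b) / 2) (1 / 2) b := by
  simpa using ((hasDerivAt_id b).const_add a).div_const 2

namespace IsC2OnStrip

theorem hasDerivAt_charMean (h : IsC2OnStrip T w D D2) {a b : ℝ} (hba : b < a) (h0 : 0 < a + b)
    (hT : a + b < 2 * T) :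
    HasDerivAt (fun a => charMean m x₀ w a b) (charMeanDeriv m x₀ w D a b) a := by
  have h1 := h.hasDerivAt_mean (ContinuousLinearMap.id ℝ E) x₀ (isCompact_closedBall (0 : E) 1)
    ae_mem_closedBall_unitSphereMeasure (I := Ioo (-b) (2 * T - b)) isOpen_Ioo
    (hasDerivAt_half_sub_left b) (hasDerivAt_half_add_left b)
    (fun s hs => ⟨by linarith [hs.1], by linarith [hs.2]⟩) (s := a)
    ⟨by linarith, by linarith⟩
  have h2 := (hasDerivAt_half_sub_left b a).rpow_const (p := m) (Or.inl (by linarith))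
  exact h2.mul h1

/-- Darboux's equation for `r ^ m ū`: the weight `m = (n - 1) / 2` removes the first-order radial
term and leaves the potential `m (1 - m) / r ^ 2`. -/
theorem hasDerivAt_charMeanDeriv (h : IsC2OnStrip T w D D2) {ι : Type*} [Fintype ι]
    (e : OrthonormalBasis ι ℝ E) (hm : (Fintype.card ι : ℝ) - 1 = 2 * m) {F : E × ℝ → ℝ}
    (heq : ∀ z ∈ (univ : Set E) ×ˢ Ioo 0 T,
      D2 z (0, 1) (0, 1) - ∑ i, D2 z (e i, 0) (e i, 0) = F z)
    {a b : ℝ} (hba : b < a) (h0 : 0 < a + b) (hT : a + b < 2 * T) :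
    HasDerivAt (fun b => charMeanDeriv m x₀ w D a b)
      (1 / 4 * ((a - b) / 2) ^ m
          * ∫ x, F (x₀ + ((a - b) / 2) • x, (a + b) / 2) ∂(unitSphereMeasure E)
        + 1 / 4 * (m * (1 - m)) * ((a - b) / 2) ^ (m - 2)
          * ∫ x, w (x₀ + ((a - b) / 2) • x, (a + b) / 2) ∂(unitSphereMeasure E)) b := by
  have hm' : MapsTo (fun b => (a + b) / 2) (Ioo (-a) (2 * T - a)) (Ioo 0 T) :=
    fun s hs => ⟨by linarith [hs.1], by linarith [hs.2]⟩
  have hb : b ∈ Ioo (-a) (2 * T - a) := ⟨by linarith, by linarith⟩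
  have ht : (a + b) / 2 ∈ Ioo 0 T := hm' hb
  have hr : 0 < (a - b) / 2 := by linarith
  have hK := isCompact_closedBall (0 : E) 1
  have hμ := ae_mem_closedBall_unitSphereMeasure (E := E)
  have h1 := h.hasDerivAt_mean (ContinuousLinearMap.id ℝ E) x₀ hK hμ isOpen_Ioo
    (hasDerivAt_half_sub_right a) (hasDerivAt_half_add_right a) hm' hb
  have h2 := h.hasDerivAt_mean_deriv (ContinuousLinearMap.id ℝ E) x₀ hK hμ isOpen_Ioo
    (hasDerivAt_half_sub_right a) (hasDerivAt_half_add_right a) hm'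
    (v := fun x => ((1 / 2 : ℝ) • x, 1 / 2)) (by fun_prop) hb
  have h3 := (hasDerivAt_half_sub_right a b).rpow_const (p := m - 1) (Or.inl hr.ne')
  have h4 := (hasDerivAt_half_sub_right a b).rpow_const (p := m) (Or.inl hr.ne')
  have h5 := ((h3.const_mul (1 / 2 * m)).mul h1).add (h4.mul h2)
  refine h5.congr_deriv ?_
  simp only [ContinuousLinearMap.coe_id', id_eq]
  have hlap := h.integral_sphere_laplacian e (ContinuousLinearMap.id ℝ E) x₀ ht hr.ne'
  simp only [ContinuousLinearMap.coe_id', id_eq, hm] at hlap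
  set r := (a - b) / 2
  set t := (a + b) / 2
  have ht' : t ∈ Ico 0 T := Ioo_subset_Ico_self ht
  have iA := (h.continuous_deriv_comp (ContinuousLinearMap.id ℝ E) x₀ (r := r) ht'
    (v := fun x => (x, 0)) (by fun_prop)).integrable_unitSphereMeasure
  have iB := (h.continuous_deriv_comp (ContinuousLinearMap.id ℝ E) x₀ (r := r) ht'
    (v := fun x => (0, 1)) (by fun_prop)).integrable_unitSphereMeasure
  have iC := (h.continuous_deriv2_comp (ContinuousLinearMap.id ℝ E) x₀ (r := r) ht
    (v := fun x => (x, 0)) (v' := fun x => (x, 0))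
    (by fun_prop) (by fun_prop)).integrable_unitSphereMeasure
  have iG := (h.continuous_deriv2_comp (ContinuousLinearMap.id ℝ E) x₀ (r := r) ht
    (v := fun x => (0, 1)) (v' := fun x => (0, 1))
    (by fun_prop) (by fun_prop)).integrable_unitSphereMeasure
  have iL : Integrable (fun x => ∑ i, D2 (x₀ + r • x, t) (e i, 0) (e i, 0))
      (unitSphereMeasure E) := integrable_finsetSum _ fun i _ =>
    (h.continuous_deriv2_comp (ContinuousLinearMap.id ℝ E) x₀ (r := r) ht
      (v := fun x => (e i, 0)) (v' := fun x => (e i, 0))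
      (by fun_prop) (by fun_prop)).integrable_unitSphereMeasure
  simp only [ContinuousLinearMap.coe_id', id_eq] at iA iB iC iG
  have vp : ∀ x : E, (((1 / 2 : ℝ) • x, 1 / 2) : E × ℝ) = (1 / 2 : ℝ) • ((x, 0) + (0, 1)) :=
    fun x => by simp
  have vm : ∀ x : E, ((-(1 / 2 : ℝ) • x, 1 / 2) : E × ℝ) = (1 / 2 : ℝ) • ((0, 1) - (x, 0)) :=
    fun x => by simp
  have e1 : ∫ x, D (x₀ + r • x, t) ((1 / 2 : ℝ) • x, 1 / 2) ∂(unitSphereMeasure E)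
      = 1 / 2 * (∫ x, D (x₀ + r • x, t) (x, 0) ∂(unitSphereMeasure E)
        + ∫ x, D (x₀ + r • x, t) (0, 1) ∂(unitSphereMeasure E)) := by
    rw [← integral_add iA iB, ← integral_const_mul]
    simp only [vp, map_smul, map_add, smul_eq_mul]
  have e2 : ∫ x, D (x₀ + r • x, t) (-(1 / 2 : ℝ) • x, 1 / 2) ∂(unitSphereMeasure E)
      = 1 / 2 * (∫ x, D (x₀ + r • x, t) (0, 1) ∂(unitSphereMeasure E)
        - ∫ x, D (x₀ + r • x, t) (x, 0) ∂(unitSphereMeasure E)) := by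
    rw [← integral_sub iB iA, ← integral_const_mul]
    simp only [vm, map_smul, map_sub, smul_eq_mul]
  have e3 : ∫ x, D2 (x₀ + r • x, t) (-(1 / 2 : ℝ) • x, 1 / 2) ((1 / 2 : ℝ) • x, 1 / 2)
        ∂(unitSphereMeasure E)
      = 1 / 4 * (∫ x, D2 (x₀ + r • x, t) (0, 1) (0, 1) ∂(unitSphereMeasure E)
        - ∫ x, D2 (x₀ + r • x, t) (x, 0) (x, 0) ∂(unitSphereMeasure E)) := by
    rw [← integral_sub iG iC, ← integral_const_mul]
    congr 1
    ext x
    simp only [vm, vp, map_smul, map_sub, map_add, smul_eq_mul, _root_.smul_apply,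
      _root_.sub_apply]
    rw [h.symm (x₀ + r • x, t) ⟨mem_univ _, ht⟩ (x, 0) (0, 1)]
    ring
  have e4 : ∫ x, F (x₀ + r • x, t) ∂(unitSphereMeasure E)
      = ∫ x, D2 (x₀ + r • x, t) (0, 1) (0, 1) ∂(unitSphereMeasure E)
        - ∫ x, ∑ i, D2 (x₀ + r • x, t) (e i, 0) (e i, 0) ∂(unitSphereMeasure E) := by
    rw [← integral_sub iG iL]
    congr 1
    ext x
    exact (heq (x₀ + r • x, t) ⟨mem_univ _, ht⟩).symm
  have iCA : Integrable (fun x => r * D2 (x₀ + r • x, t) (x, 0) (x, 0)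
      + 2 * m * D (x₀ + r • x, t) (x, 0)) (unitSphereMeasure E) :=
    (iC.const_mul r).add (iA.const_mul (2 * m))
  rw [integral_sub iCA (iL.const_mul r), integral_add (iC.const_mul r) (iA.const_mul _),
    integral_const_mul, integral_const_mul, integral_const_mul] at hlap
  have hrm : r ^ m = r * r ^ (m - 1) := by
    rw [mul_comm, ← Real.rpow_add_one hr.ne', sub_add_cancel]
  have hrm2 : r ^ (m - 1 - 1) = r ^ (m - 2) := by ring_nf
  rw [e1, e2, e3, e4, hrm, hrm2]
  linear_combination (-1 / 4 * r ^ (m - 1)) * hlap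

/-- The potential term is nonnegative for `0 ≤ m ≤ 1` and is dropped; Jensen's inequality bounds the
mean of `w ^ p` below by the power of the mean. -/
theorem exists_hasDerivAt_charMeanDeriv (h : IsC2OnStrip T w D D2) {ι : Type*} [Fintype ι]
    (e : OrthonormalBasis ι ℝ E) (hm : (Fintype.card ι : ℝ) - 1 = 2 * m) (hm0 : 0 ≤ m)
    (hm1 : m ≤ 1) {p : ℝ} (hp : 1 ≤ p)
    (heq : ∀ z ∈ (univ : Set E) ×ˢ Ioo 0 T,
      D2 z (0, 1) (0, 1) - ∑ i, D2 z (e i, 0) (e i, 0) = w z ^ p)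
    (hw : ∀ z ∈ (univ : Set E) ×ˢ Ioo 0 T, 0 ≤ w z)
    {a b : ℝ} (hba : b < a) (h0 : 0 < a + b) (hT : a + b < 2 * T) :
    ∃ q, HasDerivAt (fun b => charMeanDeriv m x₀ w D a b) q b ∧
      1 / 4 * ((a - b) / 2) ^ (m * (1 - p)) * charMean m x₀ w a b ^ p ≤ q := by
  refine ⟨_, h.hasDerivAt_charMeanDeriv e hm heq hba h0 hT, ?_⟩
  have ht : (a + b) / 2 ∈ Ioo 0 T := ⟨by linarith, by linarith⟩
  have hr : 0 < (a - b) / 2 := by linarith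
  unfold charMean
  set r := (a - b) / 2
  set t := (a + b) / 2
  have hwx : ∀ x, 0 ≤ w (x₀ + r • x, t) := fun x => hw _ ⟨mem_univ _, ht⟩
  have hwc := h.continuous_comp (ContinuousLinearMap.id ℝ E) x₀ (r := r) (Ioo_subset_Ico_self ht)
  have hI : 0 ≤ ∫ x, w (x₀ + r • x, t) ∂(unitSphereMeasure E) := integral_nonneg hwx
  have hJ := rpow_integral_le_integral_rpow hp hwx hwc.integrable_unitSphereMeasure
    (hwc.rpow_const fun x => Or.inr (by linarith)).integrable_unitSphereMeasure
  have h1 : r ^ (m * (1 - p)) * (r ^ m * ∫ x, w (x₀ + r • x, t) ∂(unitSphereMeasure E)) ^ p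
      = r ^ m * (∫ x, w (x₀ + r • x, t) ∂(unitSphereMeasure E)) ^ p := by
    rw [Real.mul_rpow (by positivity) hI, ← Real.rpow_mul hr.le, ← mul_assoc,
      ← Real.rpow_add hr]
    ring_nf
  rw [mul_assoc, h1]
  have h2 : 0 ≤ 1 / 4 * (m * (1 - m)) * r ^ (m - 2)
      * ∫ x, w (x₀ + r • x, t) ∂(unitSphereMeasure E) := by
    have : 0 ≤ 1 - m := by linarith
    positivity
  have h3 := mul_le_mul_of_nonneg_left hJ (by positivity : 0 ≤ 1 / 4 * r ^ m)
  linarith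

theorem continuousOn_charMean_left (h : IsC2OnStrip T w D D2) (hm : 0 ≤ m) {b A : ℝ} (hb : 0 ≤ b)
    (hA : A + b < 2 * T) : ContinuousOn (fun a => charMean m x₀ w a b) (Icc b A) := by
  refine ContinuousOn.mul ?_ (h.continuousOn_mean (ContinuousLinearMap.id ℝ E) x₀
    (isCompact_closedBall (0 : E) 1) ae_mem_closedBall_unitSphereMeasure isCompact_Icc
    (by fun_prop) (by fun_prop) fun s hs => ⟨by linarith [hs.1], by linarith [hs.2]⟩)
  exact ContinuousOn.rpow_const (by fun_prop) fun x _ => Or.inr hm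

theorem continuousOn_charMean_line (h : IsC2OnStrip T w D D2) (hm : 0 ≤ m) {Y : ℝ}
    (hY : 2 * Y < T) : ContinuousOn (fun y => charMean m x₀ w (3 * y) y) (Icc 0 Y) := by
  refine ContinuousOn.mul ?_ (h.continuousOn_mean (ContinuousLinearMap.id ℝ E) x₀
    (isCompact_closedBall (0 : E) 1) ae_mem_closedBall_unitSphereMeasure isCompact_Icc
    (ρ := fun y => (3 * y - y) / 2) (τ := fun y => (3 * y + y) / 2)
    (by fun_prop) (by fun_prop) fun s hs => ⟨by linarith [hs.1], by linarith [hs.2]⟩)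
  exact ContinuousOn.rpow_const (by fun_prop) fun x _ => Or.inr hm

/-- The condition `B < a` keeps `r` away from `0`, where `r ^ (m - 1)` is singular if `m < 1`. -/
theorem continuousOn_charMeanDeriv (h : IsC2OnStrip T w D D2) {a B : ℝ} (hB : B < a)
    (hT : a + B < 2 * T) : ContinuousOn (fun b => charMeanDeriv m x₀ w D a b) (Icc (-a) B) := by
  have hm' : MapsTo (fun b => (a + b) / 2) (Icc (-a) B) (Ico 0 T) :=
    fun s hs => ⟨by linarith [hs.1], by linarith [hs.2]⟩
  have hne : ∀ b ∈ Icc (-a) B, (a - b) / 2 ≠ 0 := fun b hb => by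
    have := hb.2
    exact (by linarith : 0 < (a - b) / 2).ne'
  refine ContinuousOn.add (ContinuousOn.mul (continuousOn_const.mul ?_) ?_) (ContinuousOn.mul ?_ ?_)
  · exact ContinuousOn.rpow_const (by fun_prop) fun x hx => Or.inl (hne x hx)
  · exact h.continuousOn_mean (ContinuousLinearMap.id ℝ E) x₀ (isCompact_closedBall (0 : E) 1)
      ae_mem_closedBall_unitSphereMeasure isCompact_Icc (by fun_prop) (by fun_prop) hm'
  · exact ContinuousOn.rpow_const (by fun_prop) fun x hx => Or.inl (hne x hx)
  · exact h.continuousOn_mean_deriv (ContinuousLinearMap.id ℝ E) x₀ (isCompact_closedBall (0 : E) 1)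
      ae_mem_closedBall_unitSphereMeasure isCompact_Icc (by fun_prop) (by fun_prop) hm'
      (by fun_prop)

end IsC2OnStrip

end Characteristic


/-! ### Blow-up for a damped second-order differential inequality. -/

section OrdinaryDifferentialInequality

/-- A barrier argument. Since `2q - 1 = p`, the derivative of `f ^ q` along `f' = k f ^ q` is of
size `f ^ p`, and `f ≥ η` bounds the damping by `f ^ q ≤ η ^ (q - p) f ^ p`; both are beaten by `c f
^ p`. The factor `1 - exp (-(s - s₀))` makes the barrier start at `0`, as only `f' s₀ ≥ 0` is known.
-/
theorem deriv_ge_of_second_order {p c η k q : ℝ} (hp : 1 < p) (hη : 0 < η) (hq : q = (p + 1) / 2)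
    (hk : 0 ≤ k) (hkc : 2 * k * η ^ (q - p) + k ^ 2 * q < c)
    {s₀ S : ℝ} {f f' f'' : ℝ → ℝ}
    (hf : ∀ s ∈ Icc s₀ S, HasDerivAt f (f' s) s) (hf' : ∀ s ∈ Icc s₀ S, HasDerivAt f' (f'' s) s)
    (hfη : ∀ s ∈ Icc s₀ S, η ≤ f s) (h0 : 0 ≤ f' s₀)
    (hode : ∀ s ∈ Icc s₀ S, c * f s ^ p ≤ f'' s + f' s) :
    ∀ s ∈ Icc s₀ S, k * (1 - Real.exp (-(s - s₀))) * f s ^ q ≤ f' s := by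
  have hpos : ∀ s ∈ Icc s₀ S, 0 < f s := fun s hs => hη.trans_le (hfη s hs)
  have hexp : ∀ s, HasDerivAt (fun s => k * (1 - Real.exp (-(s - s₀))))
      (k * Real.exp (-(s - s₀))) s := fun s => by
    have h1 : HasDerivAt (fun s => -(s - s₀)) (-1) s :=
      ((hasDerivAt_id s).sub_const s₀).neg
    simpa using (h1.exp.const_sub 1).const_mul k
  have hd : ∀ s ∈ Icc s₀ S, HasDerivAt (fun s => k * (1 - Real.exp (-(s - s₀))) * f s ^ q)
      (k * Real.exp (-(s - s₀)) * f s ^ q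
        + k * (1 - Real.exp (-(s - s₀))) * (f' s * q * f s ^ (q - 1))) s := fun s hs =>
    (hexp s).mul ((hf s hs).rpow_const (Or.inl (hpos s hs).ne'))
  refine image_le_of_deriv_right_lt_deriv_boundary'
    (fun s hs => (hd s hs).continuousAt.continuousWithinAt)
    (fun s hs => (hd s (Ico_subset_Icc_self hs)).hasDerivWithinAt) (by simpa using h0)
    (fun s hs => (hf' s hs).continuousAt.continuousWithinAt)
    (fun s hs => (hf' s (Ico_subset_Icc_self hs)).hasDerivWithinAt) ?_
  intro s hs heq
  have hs' := Ico_subset_Icc_self hs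
  have hfs := hpos s hs'
  have hode' := hode s hs'
  rw [← heq]
  rw [← heq] at hode'
  have hE0 : 0 < Real.exp (-(s - s₀)) := Real.exp_pos _
  have hE1 : Real.exp (-(s - s₀)) ≤ 1 := Real.exp_le_one_iff.2 (by linarith [hs.1])
  set χ := 1 - Real.exp (-(s - s₀)) with hχ
  have hχ0 : 0 ≤ χ := by linarith
  have hχ1 : χ ≤ 1 := by linarith
  have e1 : f s ^ q * f s ^ (q - 1) = f s ^ p := by
    rw [← Real.rpow_add hfs]; congr 1; linarith
  have e2 : f s ^ q ≤ f s ^ p * η ^ (q - p) := by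
    have : f s ^ (q - p) ≤ η ^ (q - p) :=
      Real.rpow_le_rpow_of_nonpos hη (hfη s hs') (by linarith)
    calc f s ^ q = f s ^ p * f s ^ (q - p) := by rw [← Real.rpow_add hfs]; congr 1; linarith
      _ ≤ _ := by gcongr
  have hQ0 : 0 < f s ^ q := Real.rpow_pos_of_pos hfs _
  have hP0 : 0 < f s ^ p := Real.rpow_pos_of_pos hfs _
  have h1 : k * χ * (k * χ * f s ^ q * q * f s ^ (q - 1)) = k ^ 2 * q * χ ^ 2 * f s ^ p := by
    rw [← e1]; ring
  rw [h1]
  have h2 : k ^ 2 * q * χ ^ 2 * f s ^ p ≤ k ^ 2 * q * f s ^ p := by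
    have : χ ^ 2 ≤ 1 := by nlinarith
    have hq0 : 0 < q := by linarith
    have : k ^ 2 * q * χ ^ 2 ≤ k ^ 2 * q * 1 := by gcongr
    nlinarith
  have h3 : k * Real.exp (-(s - s₀)) * f s ^ q + k * χ * f s ^ q = k * f s ^ q := by
    rw [hχ]; ring
  have h4 : k * f s ^ q ≤ k * (f s ^ p * η ^ (q - p)) := by gcongr
  have h5 : 0 ≤ k * (f s ^ p * η ^ (q - p)) := by positivity
  have h6 := mul_lt_mul_of_pos_right hkc hP0
  linarith

/-- Solutions of `f'' + f' ≥ c f ^ p` with `f ≥ η`, `f' ≥ 0` live at most for a time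
`1 + C η ^ (-(p - 1))`. -/
theorem exists_length_bound {p c : ℝ} (hp : 1 < p) (hc : 0 < c) :
    ∃ C > 0, ∀ η : ℝ, 0 < η → η ≤ 1 → ∀ (s₀ S : ℝ) (f f' f'' : ℝ → ℝ),
    (∀ s ∈ Icc s₀ S, HasDerivAt f (f' s) s) → (∀ s ∈ Icc s₀ S, HasDerivAt f' (f'' s) s) →
    (∀ s ∈ Icc s₀ S, η ≤ f s) → (∀ s ∈ Icc s₀ S, 0 ≤ f' s) →
    (∀ s ∈ Icc s₀ S, c * f s ^ p ≤ f'' s + f' s) →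
    S - s₀ ≤ 1 + C * η ^ (-(p - 1)) := by
  obtain ⟨q, hq⟩ : ∃ q, q = (p + 1) / 2 := ⟨_, rfl⟩
  have hq1 : 1 < q := by linarith
  obtain ⟨κ, hκ⟩ : ∃ κ, κ = min 1 (c / (2 * (2 + q))) := ⟨_, rfl⟩
  have hκ0 : 0 < κ := by rw [hκ]; exact lt_min one_pos (by positivity)
  have hκ1 : κ ≤ 1 := by rw [hκ]; exact min_le_left _ _
  have hκc : κ * (2 + q) ≤ c / 2 := by
    have : κ ≤ c / (2 * (2 + q)) := by rw [hκ]; exact min_le_right _ _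
    calc κ * (2 + q) ≤ c / (2 * (2 + q)) * (2 + q) := by gcongr
      _ = c / 2 := by field_simp
  refine ⟨2 / ((q - 1) * κ), div_pos two_pos (mul_pos (by linarith) hκ0), ?_⟩
  intro η hη hη1 s₀ S f f' f'' hf hf' hfη hf0 hode
  have hC0 : 0 < 2 / ((q - 1) * κ) := div_pos two_pos (mul_pos (by linarith) hκ0)
  have hE0 : 0 < η ^ (-(p - 1)) := Real.rpow_pos_of_pos hη _
  by_cases hS : S ≤ s₀ + 1
  · nlinarith [mul_pos hC0 hE0]
  push Not at hS
  have hηpq : 0 < η ^ (p - q) := Real.rpow_pos_of_pos hη _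
  have hηpq1 : η ^ (p - q) ≤ 1 := Real.rpow_le_one hη.le hη1 (by linarith)
  -- The largest order of `k` for which the damping, of relative size `k η ^ (q - p) = κ`, is still
  -- absorbed.
  set k := κ * η ^ (p - q) with hk
  have hk0 : 0 < k := by positivity
  have hk1 : k ≤ κ := by nlinarith
  have hkc : 2 * k * η ^ (q - p) + k ^ 2 * q < c := by
    have e : η ^ (p - q) * η ^ (q - p) = 1 := by
      rw [← Real.rpow_add hη]; simp
    have h1 : 2 * k * η ^ (q - p) = 2 * κ := by rw [hk]; linear_combination 2 * κ * e
    have h2 : k ^ 2 * q ≤ κ * q := by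
      have : k ^ 2 ≤ κ := by nlinarith
      gcongr
    rw [h1]; nlinarith
  have hineq := deriv_ge_of_second_order hp hη hq hk0.le hkc hf hf' hfη
    (hf0 s₀ ⟨le_rfl, by linarith⟩) hode
  have hsub : Icc (s₀ + 1) S ⊆ Icc s₀ S := Icc_subset_Icc_left (by linarith)
  have hpos : ∀ s ∈ Icc s₀ S, 0 < f s := fun s hs => hη.trans_le (hfη s hs)
  have hd : ∀ s ∈ Icc (s₀ + 1) S, HasDerivAt (fun s => f s ^ (1 - q))
      (f' s * (1 - q) * f s ^ (1 - q - 1)) s := fun s hs =>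
    (hf s (hsub hs)).rpow_const (Or.inl (hpos s (hsub hs)).ne')
  -- After unit time the barrier factor is at least `1/2`, so `f' ≥ (k / 2) f ^ q` and the positive
  -- quantity `f ^ (1 - q)` decreases at a definite rate.
  have hmv := (convex_Icc (s₀ + 1) S).image_sub_le_mul_sub_of_deriv_le
    (f := fun s => f s ^ (1 - q)) (C := -((q - 1) * (k / 2)))
    (fun s hs => (hd s hs).continuousAt.continuousWithinAt)
    (fun s hs => (hd s (interior_subset hs)).differentiableAt.differentiableWithinAt)
    (fun s hs => by
      have hs := interior_subset hs
      rw [(hd s hs).deriv]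
      have hfs := hpos s (hsub hs)
      have h1 := hineq s (hsub hs)
      have h2 : (1 : ℝ) / 2 ≤ 1 - Real.exp (-(s - s₀)) := by
        have h3 : Real.exp (-(s - s₀)) ≤ Real.exp (-1) := Real.exp_le_exp.2 (by linarith [hs.1])
        have h4 : Real.exp (-1) ≤ 1 / 2 := by
          rw [Real.exp_neg, inv_eq_one_div]
          exact one_div_le_one_div_of_le two_pos (by linarith [Real.add_one_le_exp 1])
        linarith
      have h5 : k / 2 * f s ^ q ≤ f' s := by
        refine le_trans ?_ h1
        have : 0 < f s ^ q := Real.rpow_pos_of_pos hfs _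
        have : k * (1 / 2) * f s ^ q ≤ k * (1 - Real.exp (-(s - s₀))) * f s ^ q := by gcongr
        linarith
      have h6 : f s ^ q * f s ^ (1 - q - 1) = 1 := by
        rw [← Real.rpow_add hfs]; simp
      have h7 : 0 < f s ^ (1 - q - 1) := Real.rpow_pos_of_pos hfs _
      have h8 := mul_le_mul_of_nonneg_right h5 h7.le
      have h9 : k / 2 ≤ f' s * f s ^ (1 - q - 1) := by
        calc k / 2 = k / 2 * f s ^ q * f s ^ (1 - q - 1) := by rw [mul_assoc, h6, mul_one]
          _ ≤ _ := h8
      nlinarith)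
    (s₀ + 1) (left_mem_Icc.2 hS.le) S (right_mem_Icc.2 hS.le) hS.le
  have hZ1 : 0 < f S ^ (1 - q) := Real.rpow_pos_of_pos (hpos S ⟨by linarith, le_rfl⟩) _
  have hZ0 : f (s₀ + 1) ^ (1 - q) ≤ η ^ (1 - q) :=
    Real.rpow_le_rpow_of_nonpos hη (hfη _ ⟨by linarith, hS.le⟩) (by linarith)
  have hb : (S - (s₀ + 1)) * ((q - 1) * (k / 2)) ≤ η ^ (1 - q) := by linarith
  have e3 : η ^ (1 - q) = η ^ (-(p - 1)) * η ^ (p - q) := by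
    rw [← Real.rpow_add hη]; congr 1; ring
  rw [e3, hk] at hb
  have hb2 : (S - (s₀ + 1)) * ((q - 1) * κ / 2) ≤ η ^ (-(p - 1)) := by
    refine le_of_mul_le_mul_right ?_ hηpq
    linarith
  have hqk : 0 < (q - 1) * κ := mul_pos (by linarith) hκ0
  have hb3 : S - (s₀ + 1) ≤ 2 / ((q - 1) * κ) * η ^ (-(p - 1)) := by
    rw [div_mul_eq_mul_div, le_div_iff₀ hqk]
    linarith
  linarith

end OrdinaryDifferentialInequality


/-! ### From the characteristic inequality to the lifespan bound. -/

section CharacteristicInequality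

/-- The properties of `U(a, b) = r ^ m ū(r, t)` in the characteristic coordinates `a = t + r`,
`b = t - r`, with `Q = ∂U/∂a`, when `ū` is a nonnegative supersolution of the radial semilinear
wave equation. -/
structure IsCharSupersolution (m p δ γ ε T : ℝ) (U Q : ℝ → ℝ → ℝ) : Prop where
  hasDerivAt_left : ∀ a b, b < a → 0 < a + b → a + b < 2 * T →
    HasDerivAt (fun a => U a b) (Q a b) a
  hasDerivAt_right : ∀ a b, b < a → 0 < a + b → a + b < 2 * T →
    ∃ q, HasDerivAt (fun b => Q a b) q b ∧ 1 / 4 * ((a - b) / 2) ^ (m * (1 - p)) * U a b ^ p ≤ q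
  nonneg : ∀ a b, b ≤ a → 0 ≤ a + b → a + b < 2 * T → 0 ≤ U a b
  self : ∀ b, U b b = 0
  continuousOn_left : ∀ b A, 0 ≤ b → A + b < 2 * T → ContinuousOn (fun a => U a b) (Icc b A)
  continuousOn_line : ∀ Y, 2 * Y < T → ContinuousOn (fun y => U (3 * y) y) (Icc 0 Y)
  continuousOn_right : ∀ a B, B < a → a + B < 2 * T → ContinuousOn (fun b => Q a b) (Icc (-a) B)
  initial_nonneg : ∀ a, 0 < a → 0 ≤ Q a (-a)
  initial_ge : ∀ a, 0 < a → a ≤ δ → ε * γ * a ^ m ≤ Q a (-a)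

namespace IsCharSupersolution

variable {m p δ γ ε T : ℝ} {U Q : ℝ → ℝ → ℝ}

/-- Integrates the inequality in `b` without integrals: `Ψ` is a primitive of a minorant `ψ` of the
source. `left_sub_ge` does the same in `a`. -/
theorem sub_monotoneOn (h : IsCharSupersolution m p δ γ ε T U Q) {a B B₀ : ℝ} (hB : B < a)
    (hT : a + B < 2 * T) (hB0 : -a ≤ B₀) {Ψ ψ : ℝ → ℝ} (hΨ : ∀ b, HasDerivAt Ψ (ψ b) b)
    (hψ : ∀ b ∈ Ioo B₀ B, ψ b ≤ 1 / 4 * ((a - b) / 2) ^ (m * (1 - p)) * U a b ^ p) :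
    MonotoneOn (fun b => Q a b - Ψ b) (Icc B₀ B) := by
  refine monotoneOn_of_deriv_nonneg (convex_Icc _ _) ?_ ?_ ?_
  · exact ((h.continuousOn_right a B hB hT).mono (Icc_subset_Icc_left hB0)).sub
      (fun b _ => (hΨ b).continuousAt.continuousWithinAt)
  all_goals
    rw [interior_Icc]
    intro b hb
    obtain ⟨q, hq, hle⟩ := h.hasDerivAt_right a b (hb.2.trans hB) (by linarith [hb.1])
      (by linarith [hb.2])
  · exact (hq.fun_sub (hΨ b)).differentiableAt.differentiableWithinAt
  · rw [(hq.fun_sub (hΨ b)).deriv]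
    linarith [hψ b hb]

theorem monotoneOn_right (h : IsCharSupersolution m p δ γ ε T U Q) {a B : ℝ} (hB : B < a)
    (hT : a + B < 2 * T) : MonotoneOn (fun b => Q a b) (Icc (-a) B) := by
  have := h.sub_monotoneOn hB hT le_rfl (fun b => hasDerivAt_const b (0 : ℝ)) (fun b hb => by
    have h1 := h.nonneg a b (hb.2.trans hB).le (by linarith [hb.1]) (by linarith [hb.2])
    have h2 : 0 ≤ (a - b) / 2 := by linarith [hb.2]
    positivity)
  simpa using this

theorem deriv_ge_initial (h : IsCharSupersolution m p δ γ ε T U Q) {a b : ℝ} (hb : b < a)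
    (h0 : 0 ≤ a + b) (hT : a + b < 2 * T) : Q a (-a) ≤ Q a b :=
  h.monotoneOn_right hb hT ⟨le_rfl, by linarith⟩ ⟨by linarith, le_rfl⟩ (by linarith)

theorem deriv_nonneg (h : IsCharSupersolution m p δ γ ε T U Q) {a b : ℝ} (hb : b < a)
    (h0 : 0 ≤ a + b) (hT : a + b < 2 * T) : 0 ≤ Q a b :=
  (h.initial_nonneg a (by linarith)).trans (h.deriv_ge_initial hb h0 hT)

theorem left_sub_ge (h : IsCharSupersolution m p δ γ ε T U Q) {b A₀ A : ℝ} (hb : 0 < b)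
    (hA : b ≤ A₀) (hAA : A₀ ≤ A) (hT : A + b < 2 * T) {Ψ ψ : ℝ → ℝ}
    (hΨ : ∀ a, HasDerivAt Ψ (ψ a) a) (hψ : ∀ a ∈ Ioo A₀ A, ψ a ≤ Q a b) :
    Ψ A - Ψ A₀ ≤ U A b - U A₀ b := by
  have hm : MonotoneOn (fun a => U a b - Ψ a) (Icc A₀ A) := by
    refine monotoneOn_of_deriv_nonneg (convex_Icc _ _) ?_ ?_ ?_
    · exact ((h.continuousOn_left b A hb.le hT).mono (Icc_subset_Icc_left hA)).sub
        (fun b _ => (hΨ b).continuousAt.continuousWithinAt)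
    all_goals
      rw [interior_Icc]
      intro a ha
      have hd := h.hasDerivAt_left a b (hA.trans_lt ha.1) (by linarith [ha.1]) (by linarith [ha.2])
    · exact (hd.fun_sub (hΨ a)).differentiableAt.differentiableWithinAt
    · rw [(hd.fun_sub (hΨ a)).deriv]
      linarith [hψ a ha]
  have := hm (left_mem_Icc.2 hAA) (right_mem_Icc.2 hAA) hAA
  simp only at this
  linarith

theorem left_mono (h : IsCharSupersolution m p δ γ ε T U Q) {b A₀ A : ℝ} (hb : 0 < b)
    (hA : b ≤ A₀) (hAA : A₀ ≤ A) (hT : A + b < 2 * T) : U A₀ b ≤ U A b := by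
  have := h.left_sub_ge hb hA hAA hT (fun a => hasDerivAt_const a (0 : ℝ))
    (fun a ha => h.deriv_nonneg (hA.trans_lt ha.1) (by linarith [ha.1]) (by linarith [ha.2]))
  linarith

/-- The lower bound of the linear part near the light cone. -/
theorem linear_lower_bound (h : IsCharSupersolution m p δ γ ε T U Q) (hm : 0 ≤ m)
    (hεγ : 0 ≤ ε * γ) {a b : ℝ} (hb : 0 < b) (hbδ : b ≤ δ / 2) (ha : δ ≤ a) (hT : a + b < 2 * T) :
    ε * γ * (δ / 2) ^ m * (δ / 2) ≤ U a b := by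
  have h1 := h.left_mono hb (by linarith) ha hT
  -- Only `a ∈ [δ/2, δ]` contributes, where the data are positive and `a ^ m ≥ (δ/2) ^ m`; beyond
  -- `δ`, `U` is nondecreasing in `a`.
  have h2 := h.left_sub_ge (A := δ) hb hbδ (by linarith) (by linarith)
    (Ψ := fun a => a * (ε * γ * (δ / 2) ^ m)) (ψ := fun a => 1 * (ε * γ * (δ / 2) ^ m))
    (fun a => (hasDerivAt_id a).mul_const _) (fun a ha => by
      have h3 := h.initial_ge a (by linarith [ha.1]) ha.2.le
      have h4 := h.deriv_ge_initial (a := a) (b := b) (by linarith [ha.1]) (by linarith [ha.1])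
        (by linarith [ha.2])
      have h5 : (δ / 2) ^ m ≤ a ^ m := Real.rpow_le_rpow (by linarith) ha.1.le hm
      have h6 := mul_le_mul_of_nonneg_left h5 hεγ
      linarith)
  have h3 := h.nonneg (δ / 2) b hbδ (by linarith) (by linarith)
  linarith

theorem rpow_half_sub_ge (hm : 0 ≤ m) (hp : 1 ≤ p) {a b y : ℝ} (hba : b < a) (hb : 0 ≤ b)
    (hay : a ≤ 3 * y) :
    (3 / 2 * y) ^ (m * (1 - p)) ≤ ((a - b) / 2) ^ (m * (1 - p)) :=
  Real.rpow_le_rpow_of_nonpos (by linarith) (by linarith)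
    (mul_nonpos_of_nonneg_of_nonpos hm (by linarith))

/-- The source is integrated over the rectangle `0 < b < δ/2`, `y < a < 3y`, of area `δ y`, where
the linear lower bound holds and `r ≤ 3y/2`. -/
theorem line_lower_bound (h : IsCharSupersolution m p δ γ ε T U Q) (hm : 0 ≤ m) (hp : 1 ≤ p)
    (hδ : 0 < δ) (hεγ : 0 ≤ ε * γ) {y : ℝ} (hy : δ ≤ y) (hT : 2 * y < T) :
    1 / 4 * (3 / 2 * y) ^ (m * (1 - p)) * (ε * γ * (δ / 2) ^ m * (δ / 2)) ^ p * δ * y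
      ≤ U (3 * y) y := by
  obtain ⟨A, hA⟩ : ∃ A, A = 1 / 4 * (3 / 2 * y) ^ (m * (1 - p))
    * (ε * γ * (δ / 2) ^ m * (δ / 2)) ^ p := ⟨_, rfl⟩
  have hy0 : 0 < y := hδ.trans_le hy
  have h1 := h.left_sub_ge (b := y) (A₀ := y) (A := 3 * y) hy0 le_rfl (by linarith) (by linarith)
    (Ψ := fun a => a * (A * (δ / 2))) (ψ := fun a => 1 * (A * (δ / 2)))
    (fun a => (hasDerivAt_id a).mul_const _) (fun a ha => by
      have h2 := h.sub_monotoneOn (a := a) (B₀ := 0) (B := δ / 2) (by linarith [ha.1])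
        (by linarith [ha.2]) (by linarith [ha.1]) (Ψ := fun b => b * A) (ψ := fun b => 1 * A)
        (fun b => (hasDerivAt_id b).mul_const _) (fun b hb => by
          have h3 := h.linear_lower_bound hm hεγ (a := a) hb.1 hb.2.le (by linarith [ha.1])
            (by linarith [ha.2, hb.2])
          have h4 := rpow_half_sub_ge hm hp (a := a) (b := b) (y := y)
            (by linarith [ha.1, hb.2]) hb.1.le ha.2.le
          have h0 : 0 ≤ (a - b) / 2 := by linarith [ha.1, hb.2]
          rw [hA, one_mul]
          gcongr)
      have h5 := h2 ⟨le_rfl, by linarith⟩ ⟨by linarith, le_rfl⟩ (by linarith : (0 : ℝ) ≤ δ / 2)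
      have h6 := h.deriv_nonneg (a := a) (b := 0) (by linarith [ha.1]) (by linarith [ha.1])
        (by linarith [ha.2])
      have h7 := h.monotoneOn_right (a := a) (B := y) ha.1 (by linarith [ha.2])
        ⟨by linarith [ha.1], by linarith⟩ ⟨by linarith [ha.1], le_rfl⟩ (by linarith : δ / 2 ≤ y)
      simp only at h5 h7
      linarith)
  rw [h.self] at h1
  rw [← hA]
  linarith

/-- The source is integrated over `0 < b < a/3`, `y < a < 3y`. There `3b < a`, so monotonicity in
`a` gives `U a b ≥ U (3b) b`; the inner integral is `Φ (a/3)`, the outer one yields the difference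
of `W`. -/
theorem line_iteration (h : IsCharSupersolution m p δ γ ε T U Q) (hm : 0 ≤ m) (hp : 1 ≤ p)
    {Y : ℝ} (hYT : 2 * Y < T) {Φ W φ : ℝ → ℝ} (hφ : ∀ y ∈ Ioc 0 Y, φ y = U (3 * y) y ^ p)
    (hΦ : ∀ y, HasDerivAt Φ (φ y) y) (hW : ∀ y, HasDerivAt W (Φ y) y) (hΦ0 : Φ 0 = 0)
    {y : ℝ} (hy0 : 0 < y) (hyY : y ≤ Y) :
    3 / 4 * (3 / 2 * y) ^ (m * (1 - p)) * (W y - W (y / 3)) ≤ U (3 * y) y := by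
  obtain ⟨A, hA⟩ : ∃ A, A = 1 / 4 * (3 / 2 * y) ^ (m * (1 - p)) := ⟨_, rfl⟩
  have h1 := h.left_sub_ge (b := y) (A₀ := y) (A := 3 * y) hy0 le_rfl (by linarith) (by linarith)
    (Ψ := fun a => 3 * A * W (a / 3)) (ψ := fun a => 3 * A * (Φ (a / 3) * (1 / 3)))
    (fun a => ((hW (a / 3)).comp a ((hasDerivAt_id a).div_const 3)).const_mul _) (fun a ha => by
      have h2 := h.sub_monotoneOn (a := a) (B₀ := 0) (B := a / 3) (by linarith [ha.1])
        (by linarith [ha.2]) (by linarith [ha.1]) (Ψ := fun b => A * Φ b) (ψ := fun b => A * φ b)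
        (fun b => (hΦ b).const_mul A) (fun b hb => by
          have hbY : b ≤ Y := by linarith [hb.2, ha.2]
          have h3 := h.left_mono (b := b) (A₀ := 3 * b) (A := a) hb.1 (by linarith [hb.1])
            (by linarith [hb.2]) (by linarith [hb.2, ha.2])
          have h4 := rpow_half_sub_ge hm hp (a := a) (b := b) (y := y)
            (by linarith [ha.1, hb.2]) hb.1.le ha.2.le
          have h0 : 0 ≤ (a - b) / 2 := by linarith [ha.1, hb.2]
          have h00 := h.nonneg (3 * b) b (by linarith [hb.1]) (by linarith [hb.1])
            (by linarith [hb.2, ha.2])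
          rw [hφ b ⟨hb.1, hbY⟩, hA]
          gcongr)
      have h5 := h2 ⟨le_rfl, by linarith [ha.1]⟩ ⟨by linarith [ha.1], le_rfl⟩
        (by linarith [ha.1] : (0 : ℝ) ≤ a / 3)
      have h6 := h.deriv_nonneg (a := a) (b := 0) (by linarith [ha.1]) (by linarith [ha.1])
        (by linarith [ha.2])
      have h7 := h.monotoneOn_right (a := a) (B := y) ha.1 (by linarith [ha.2])
        ⟨by linarith [ha.1], by linarith [ha.2]⟩ ⟨by linarith [ha.1], le_rfl⟩
        (by linarith [ha.2] : a / 3 ≤ y)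
      simp only [hΦ0] at h5 h7
      linarith)
  simp only [h.self] at h1
  rw [show 3 * y / 3 = y by ring] at h1
  have e : 3 / 4 * (3 / 2 * y) ^ (m * (1 - p)) = 3 * A := by rw [hA]; ring
  rw [e]
  linarith

end IsCharSupersolution

theorem primitive_bounds {φ Φ W : ℝ → ℝ} (hφ0 : ∀ y, 0 ≤ φ y) (hΦ : ∀ y, HasDerivAt Φ (φ y) y)
    (hW : ∀ y, HasDerivAt W (Φ y) y) {x y : ℝ} (hxy : x ≤ y) :
    Φ x * (y - x) ≤ W y - W x ∧ W y - W x ≤ Φ y * (y - x) := by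
  have hΦm : Monotone Φ := monotone_of_deriv_nonneg (fun y => (hΦ y).differentiableAt)
    fun y => by rw [(hΦ y).deriv]; exact hφ0 y
  have hWc : ContinuousOn W (Icc x y) := fun z _ => (hW z).continuousAt.continuousWithinAt
  have hWd : DifferentiableOn ℝ W (interior (Icc x y)) := fun z _ =>
    (hW z).differentiableAt.differentiableWithinAt
  constructor
  · exact (convex_Icc x y).mul_sub_le_image_sub_of_le_deriv hWc hWd
      (fun z hz => by rw [(hW z).deriv]; exact hΦm (interior_subset hz).1)
      x (left_mem_Icc.2 hxy) y (right_mem_Icc.2 hxy) hxy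
  · exact (convex_Icc x y).image_sub_le_mul_sub_of_deriv_le hWc hWd
      (fun z hz => by rw [(hW z).deriv]; exact hΦm (interior_subset hz).2)
      x (left_mem_Icc.2 hxy) y (right_mem_Icc.2 hxy) hxy

/-- The passage to the logarithmic variable `s = log y` in
`φ ≥ c y ^ (-(p + 1)) (η y + W) ^ p`, `W'' = φ`. -/
theorem exists_log_bound {p c : ℝ} (hp : 1 < p) (hc : 0 < c) :
    ∃ C > 0, ∀ η : ℝ, 0 < η → η ≤ 1 → ∀ (δ Y : ℝ) (φ Φ W : ℝ → ℝ), 0 < δ → δ ≤ Y →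
    (∀ y, 0 ≤ φ y) → (∀ y, HasDerivAt Φ (φ y) y) → (∀ y, HasDerivAt W (Φ y) y) →
    Φ 0 = 0 → W 0 = 0 →
    (∀ y ∈ Icc δ Y, c * y ^ (-(p + 1)) * (η * y + W y) ^ p ≤ φ y) →
    Real.log Y - Real.log δ ≤ 1 + C * η ^ (-(p - 1)) := by
  obtain ⟨C, hC, hmain⟩ := exists_length_bound hp hc
  refine ⟨C, hC, ?_⟩
  intro η hη hη1 δ Y φ Φ W hδ hδY hφ0 hΦ hW hΦ0 hW0 hineq
  have hWnn : ∀ y, 0 ≤ y → 0 ≤ W y := fun y hy => by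
    have := (primitive_bounds hφ0 hΦ hW hy).1
    rw [hΦ0, hW0] at this
    linarith
  have hexp : ∀ s, HasDerivAt (fun s => Real.exp (-s)) (-Real.exp (-s)) s := fun s => by
    simpa using (hasDerivAt_neg s).exp
  have hee : ∀ s, Real.exp s * Real.exp (-s) = 1 := fun s => by rw [← Real.exp_add]; simp
  -- With `y = exp s` the function is `f = η + W / y`, so `f' = Φ - W / y` and `f'' + f' = φ y`.
  refine hmain η hη hη1 (Real.log δ) (Real.log Y)
    (fun s => η + W (Real.exp s) * Real.exp (-s))
    (fun s => Φ (Real.exp s) - W (Real.exp s) * Real.exp (-s))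
    (fun s => φ (Real.exp s) * Real.exp s - (Φ (Real.exp s) - W (Real.exp s) * Real.exp (-s)))
    (fun s _ => ?_) (fun s _ => ?_) (fun s _ => ?_) (fun s _ => ?_) (fun s hs => ?_)
  · refine ((((hW _).comp s (Real.hasDerivAt_exp s)).mul (hexp s)).const_add η).congr_deriv ?_
    simp only [Function.comp]
    linear_combination Φ (Real.exp s) * hee s
  · refine (((hΦ _).comp s (Real.hasDerivAt_exp s)).sub
      (((hW _).comp s (Real.hasDerivAt_exp s)).mul (hexp s))).congr_deriv ?_
    simp only [Function.comp]
    linear_combination (-Φ (Real.exp s)) * hee s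
  · have := hWnn _ (Real.exp_pos s).le
    have := mul_nonneg this (Real.exp_pos (-s)).le
    linarith
  · have h1 := (primitive_bounds hφ0 hΦ hW (Real.exp_pos s).le).2
    rw [hW0, sub_zero, sub_zero] at h1
    have h2 := mul_le_mul_of_nonneg_right h1 (Real.exp_pos (-s)).le
    rw [mul_assoc, hee, mul_one] at h2
    linarith
  · have hy : Real.exp s ∈ Icc δ Y := by
      constructor
      · rw [← Real.log_le_iff_le_exp hδ]; exact hs.1
      · rw [← Real.le_log_iff_exp_le (by linarith)]; exact hs.2
    have hy0 := Real.exp_pos s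
    have h1 := mul_le_mul_of_nonneg_right (hineq _ hy) hy0.le
    have hWy := hWnn _ hy0.le
    have h2 : η * Real.exp s + W (Real.exp s)
        = Real.exp s * (η + W (Real.exp s) * Real.exp (-s)) := by
      linear_combination (-W (Real.exp s)) * hee s
    have h3 : 0 ≤ η + W (Real.exp s) * Real.exp (-s) := by positivity
    have h4 : Real.exp s ^ (-(p + 1)) * Real.exp s ^ p * Real.exp s = 1 := by
      rw [← Real.rpow_add hy0, ← Real.rpow_add_one hy0.ne']
      ring_nf
      simp
    rw [h2, Real.mul_rpow hy0.le h3] at h1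
    have h5 : c * Real.exp s ^ (-(p + 1)) * (Real.exp s ^ p
        * (η + W (Real.exp s) * Real.exp (-s)) ^ p) * Real.exp s
        = c * (η + W (Real.exp s) * Real.exp (-s)) ^ p := by
      linear_combination c * (η + W (Real.exp s) * Real.exp (-s)) ^ p * h4
    linarith

theorem exists_lifespan_bound {m p δ γ : ℝ} (hm : 0 < m) (hp : 1 < p)
    (hmp : m * p * (p - 1) = p + 1) (hδ : 0 < δ) (hγ : 0 < γ) :
    ∃ C > 0, ∀ ε T : ℝ, 0 < ε → ε ≤ 1 → 0 < T →
      ∀ U Q : ℝ → ℝ → ℝ, IsCharSupersolution m p δ γ ε T U Q →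
      T ≤ Real.exp (C * ε ^ (-(p * (p - 1)))) := by
  obtain ⟨B, hB⟩ : ∃ B, B = (γ * (δ / 2) ^ m * (δ / 2)) ^ p * δ / 4 := ⟨_, rfl⟩
  have hB0 : 0 < B := by rw [hB]; positivity
  obtain ⟨c₁, hc₁⟩ : ∃ c₁, c₁ = 1 / 2 * min B (1 / 2) * (3 / 2) ^ (m * (1 - p)) := ⟨_, rfl⟩
  have hmin : 0 < min B (1 / 2) := lt_min hB0 (by norm_num)
  have hc₁0 : 0 < c₁ := by rw [hc₁]; positivity
  obtain ⟨C, hC, hlog⟩ := exists_log_bound hp (c := c₁ ^ p) (by positivity)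
  refine ⟨C + 1 + |Real.log (2 * δ)|, by positivity, ?_⟩
  intro ε T hε hε1 hT U Q h
  have hηE : ε ^ (-(p * (p - 1))) = (ε ^ p) ^ (-(p - 1)) := by
    rw [← Real.rpow_mul hε.le]; ring_nf
  have hη : 0 < ε ^ p := Real.rpow_pos_of_pos hε _
  have hη1 : ε ^ p ≤ 1 := Real.rpow_le_one hε.le hε1 (by linarith)
  have hE1 : 1 ≤ (ε ^ p) ^ (-(p - 1)) :=
    Real.one_le_rpow_of_pos_of_le_one_of_nonpos hη hη1 (by linarith)
  have hbound : ∀ Y, δ ≤ Y → 2 * Y < T →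
      Real.log Y - Real.log δ ≤ 1 + C * (ε ^ p) ^ (-(p - 1)) := by
    intro Y hδY hYT
    have hY0 : 0 ≤ Y := by linarith
    have hwc := h.continuousOn_line Y hYT
    -- The values on the ray, extended by constants outside `[0, Y]` so that the primitives `Φ` and
    -- `W` exist on the whole line.
    let w : ℝ → ℝ := fun y => U (3 * (projIcc 0 Y hY0 y : ℝ)) (projIcc 0 Y hY0 y : ℝ)
    have hw : ∀ y ∈ Icc 0 Y, w y = U (3 * y) y := fun y hy => by
      simp only [w, projIcc_of_mem hY0 hy]
    have hwcont : Continuous w := hwc.comp_continuous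
      (f := fun y => (projIcc 0 Y hY0 y : ℝ)) (by fun_prop) fun y => (projIcc 0 Y hY0 y).2
    have hw0 : ∀ y, 0 ≤ w y := fun y => by
      have hz := (projIcc 0 Y hY0 y).2
      exact h.nonneg _ _ (by linarith [hz.1]) (by linarith [hz.1]) (by linarith [hz.2])
    have hφc : Continuous (fun y => w y ^ p) := hwcont.rpow_const fun _ => Or.inr (by linarith)
    let Φ : ℝ → ℝ := fun y => ∫ x in (0 : ℝ)..y, w x ^ p
    let W : ℝ → ℝ := fun y => ∫ x in (0 : ℝ)..y, Φ x
    have hΦ : ∀ y, HasDerivAt Φ (w y ^ p) y := fun y => hφc.integral_hasStrictDerivAt 0 y |>.hasDerivAt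
    have hΦc : Continuous Φ := continuous_iff_continuousAt.2 fun y => (hΦ y).continuousAt
    have hW : ∀ y, HasDerivAt W (Φ y) y := fun y => hΦc.integral_hasStrictDerivAt 0 y |>.hasDerivAt
    have hΦ0 : Φ 0 = 0 := by simp [Φ]
    have hW0 : W 0 = 0 := by simp [W]
    have hφ0 : ∀ y, 0 ≤ w y ^ p := fun y => Real.rpow_nonneg (hw0 y) p
    refine hlog (ε ^ p) hη hη1 δ Y _ Φ W hδ hδY hφ0 hΦ hW hΦ0 hW0 ?_
    intro y hy
    have hy0 : 0 < y := hδ.trans_le hy.1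
    have l1 := h.line_lower_bound hm.le hp.le hδ (by positivity) hy.1 (by linarith [hy.2])
    have l2 := h.line_iteration hm.le hp.le hYT (φ := fun y => w y ^ p)
      (fun y hy => by simp only [hw y (Ioc_subset_Icc_self hy)]) hΦ hW hΦ0 hy0 hy.2
    have b1 := (primitive_bounds hφ0 hΦ hW (by linarith : y / 3 ≤ y)).1
    have b2 := (primitive_bounds hφ0 hΦ hW (by linarith : (0 : ℝ) ≤ y / 3)).2
    have b3 := (primitive_bounds hφ0 hΦ hW hy0.le).1
    rw [hW0] at b2
    rw [hΦ0, hW0] at b3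
    have hWy : 0 ≤ W y := by linarith
    -- Convexity of `W` and `W 0 = 0` give `W (y / 3) ≤ W y / 3`.
    have b4 : 2 / 3 * W y ≤ W y - W (y / 3) := by linarith
    rw [← hw y ⟨hy0.le, hy.2⟩] at l1 l2
    have e1 : (3 / 2 * y) ^ (m * (1 - p)) = (3 / 2) ^ (m * (1 - p)) * y ^ (m * (1 - p)) :=
      Real.mul_rpow (by norm_num) hy0.le
    have e2 : (ε * γ * (δ / 2) ^ m * (δ / 2)) ^ p = ε ^ p * (γ * (δ / 2) ^ m * (δ / 2)) ^ p := by
      rw [← Real.mul_rpow hε.le (by positivity)]; ring_nf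
    obtain ⟨A, hA⟩ : ∃ A, A = (3 / 2 * y) ^ (m * (1 - p)) := ⟨_, rfl⟩
    have hA0 : 0 < A := by rw [hA]; positivity
    rw [← hA] at l1 l2
    rw [e2] at l1
    have l1' : A * (min B (1 / 2) * (ε ^ p * y)) ≤ w y := by
      have h1 : A * (min B (1 / 2) * (ε ^ p * y)) ≤ A * (B * (ε ^ p * y)) :=
        mul_le_mul_of_nonneg_left
          (mul_le_mul_of_nonneg_right (min_le_left _ _) (by positivity)) hA0.le
      refine (h1.trans (le_of_eq ?_)).trans l1
      rw [hB]; ring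
    have l2' : A * (min B (1 / 2) * W y) ≤ w y := by
      refine le_trans ?_ l2
      have h1 : A * (min B (1 / 2) * W y) ≤ A * (1 / 2 * W y) := mul_le_mul_of_nonneg_left
          (mul_le_mul_of_nonneg_right (min_le_right _ _) hWy) hA0.le
      have h2 := mul_le_mul_of_nonneg_left b4 hA0.le
      linarith
    -- The average of the two lower bounds, whence the factor `1 / 2` in `c₁`.
    have l3 : c₁ * y ^ (m * (1 - p)) * (ε ^ p * y + W y) ≤ w y := by
      have : c₁ * y ^ (m * (1 - p)) = 1 / 2 * min B (1 / 2) * A := by rw [hA, e1, hc₁]; ring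
      rw [this]
      linarith
    have hsum : 0 ≤ ε ^ p * y + W y := by positivity
    have l4 := Real.rpow_le_rpow (by positivity) l3 (by linarith : 0 ≤ p)
    rw [Real.mul_rpow (by positivity) hsum, Real.mul_rpow hc₁0.le (by positivity),
      ← Real.rpow_mul hy0.le] at l4
    -- Criticality of `p` enters here.
    have e3 : m * (1 - p) * p = -(p + 1) := by linear_combination -hmp
    rwa [e3] at l4
  rw [hηE]
  set X := (ε ^ p) ^ (-(p - 1))
  have hT2 : T / 2 ≤ δ * Real.exp (1 + C * X) := by
    by_contra! hcon
    have hX : 1 < Real.exp (1 + C * X) := Real.one_lt_exp_iff.2 (by positivity)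
    obtain ⟨Y, hY1, hY2⟩ := exists_between hcon
    have hδY : δ ≤ Y := by nlinarith
    have h1 := hbound Y hδY (by linarith)
    have h2 : Real.log (δ * Real.exp (1 + C * X)) < Real.log Y :=
      Real.log_lt_log (by positivity) hY1
    rw [Real.log_mul hδ.ne' (Real.exp_pos _).ne', Real.log_exp] at h2
    linarith
  have h3 : T ≤ Real.exp (Real.log (2 * δ)) * Real.exp (1 + C * X) := by
    rw [Real.exp_log (by linarith)]; linarith
  rw [← Real.exp_add] at h3
  refine h3.trans (Real.exp_le_exp.2 ?_)
  have h4 := le_abs_self (Real.log (2 * δ))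
  have h5 := abs_nonneg (Real.log (2 * δ))
  -- Since `ε ≤ 1`, `X ≥ 1` absorbs the additive constants `1` and `log (2 δ)` into the coefficient
  -- of `X`.
  nlinarith

end CharacteristicInequality


/-! ### The Strauss exponent and application to classical solutions. -/

section Strauss

theorem straussExponent_critical {n : ℕ} (hn : 2 ≤ n) {p : ℝ} (hp : p = straussExponent n) :
    1 < p ∧ ((n : ℝ) - 1) / 2 * p * (p - 1) = p + 1 := by
  have hn' : (2 : ℝ) ≤ n := by exact_mod_cast hn
  have hp0 : 0 < p := by
    rw [hp, straussExponent]
    exact div_pos (by positivity) (by linarith)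
  have hγ := (straussGamma_eq_zero_iff hn hp0).2 hp
  have hmp : ((n : ℝ) - 1) / 2 * p * (p - 1) = p + 1 := by
    unfold straussGamma at hγ
    linear_combination -hγ
  refine ⟨?_, hmp⟩
  by_contra! hle
  have h1 : 0 < ((n : ℝ) - 1) / 2 * p := by
    have : 0 < (n : ℝ) - 1 := by linarith
    positivity
  nlinarith

/-- Descent: for `n = 2` the projection kills the third coordinate, so the three-dimensional
Laplacian of the lifted function is the planar one. -/
theorem exists_projection {n : ℕ} (hn : n = 2 ∨ n = 3) :
    ∃ P : EuclideanSpace ℝ (Fin 3) →L[ℝ] EuclideanSpace ℝ (Fin n),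
      ∀ B : EuclideanSpace ℝ (Fin n) → ℝ, B 0 = 0 →
        ∑ i, B (P (EuclideanSpace.basisFun (Fin 3) ℝ i))
          = ∑ j, B (EuclideanSpace.basisFun (Fin n) ℝ j) := by
  rcases hn with rfl | rfl
  · refine ⟨(EuclideanSpace.proj 0).smulRight (EuclideanSpace.basisFun (Fin 2) ℝ 0)
      + (EuclideanSpace.proj 1).smulRight (EuclideanSpace.basisFun (Fin 2) ℝ 1), fun B hB => ?_⟩
    simp [Fin.sum_univ_two, Fin.sum_univ_three, hB]
  · exact ⟨ContinuousLinearMap.id ℝ _, fun B _ => rfl⟩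

variable {n : ℕ} {p ε T : ℝ} {f g : EuclideanSpace ℝ (Fin n) → ℝ}
  {u : EuclideanSpace ℝ (Fin n) → ℝ → ℝ}

theorem IsClassicalSolution.wave_equation (hu : IsClassicalSolution n p ε f g T u)
    {D : EuclideanSpace ℝ (Fin n) × ℝ → EuclideanSpace ℝ (Fin n) × ℝ →L[ℝ] ℝ}
    {D2 : EuclideanSpace ℝ (Fin n) × ℝ →
      EuclideanSpace ℝ (Fin n) × ℝ →L[ℝ] EuclideanSpace ℝ (Fin n) × ℝ →L[ℝ] ℝ}
    (h : IsC2OnStrip T (fun z : EuclideanSpace ℝ (Fin n) × ℝ => u z.1 z.2) D D2)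
    {z : EuclideanSpace ℝ (Fin n) × ℝ} (hz : z ∈ univ ×ˢ Ioo 0 T) :
    D2 z (0, 1) (0, 1) - ∑ i, D2 z (EuclideanSpace.basisFun (Fin n) ℝ i, 0)
      (EuclideanSpace.basisFun (Fin n) ℝ i, 0) = |u z.1 z.2| ^ p := by
  obtain ⟨x, t⟩ := z
  have ht : t ∈ Ioo 0 T := hz.2
  rw [← hu.equation x t ht, ← h.iteratedDeriv_two_time x ht,
    InnerProductSpace.laplacian_eq_iteratedFDeriv_orthonormalBasis _
      (EuclideanSpace.basisFun (Fin n) ℝ)]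
  congr 1
  refine Finset.sum_congr rfl fun i _ => ?_
  rw [iteratedFDeriv_two_apply]
  have := h.fderiv_fderiv_slice_apply (ContinuousLinearMap.id ℝ _) 0 ht x
    (EuclideanSpace.basisFun (Fin n) ℝ i) (EuclideanSpace.basisFun (Fin n) ℝ i)
  simp only [ContinuousLinearMap.coe_id', id_eq, zero_add] at this
  rw [← this]
  rfl

theorem IsClassicalSolution.isCharSupersolution (hn : n = 2 ∨ n = 3) (hp : 1 ≤ p) (hε : 0 < ε)
    (hT : 0 < T) (hf : ∀ x, f x = 0) (hg : Continuous g) (hg_nonneg : ∀ x, 0 ≤ g x)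
    (hu : IsClassicalSolution n p ε f g T u) {x₀ : EuclideanSpace ℝ (Fin n)} {δ γ : ℝ}
    (hγ : ∀ x ∈ Metric.closedBall x₀ δ, 2 * γ ≤ g x) :
    ∃ U Q, IsCharSupersolution (((n : ℝ) - 1) / 2) p δ γ ε T U Q := by
  have hn2 : (2 : ℝ) ≤ n := by rcases hn with rfl | rfl <;> norm_num
  have hn3 : (n : ℝ) ≤ 3 := by rcases hn with rfl | rfl <;> norm_num
  have : Nontrivial (EuclideanSpace ℝ (Fin n)) :=
    Module.nontrivial_of_finrank_pos (R := ℝ) (by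
      rw [finrank_euclideanSpace_fin]; rcases hn with rfl | rfl <;> norm_num)
  have h := IsC2OnStrip.of_contDiffOn hu.contDiffOn
  obtain ⟨D, hD⟩ : ∃ D, D = fderivWithin ℝ
    (fun z : EuclideanSpace ℝ (Fin n) × ℝ => u z.1 z.2) (univ ×ˢ Ico 0 T) := ⟨_, rfl⟩
  rw [← hD] at h
  obtain ⟨w, hw⟩ : ∃ w, w = fun z : EuclideanSpace ℝ (Fin n) × ℝ => u z.1 z.2 := ⟨_, rfl⟩
  have heq := fun z hz => hu.wave_equation h (z := z) hz
  rw [← hw] at h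
  have h0 : ∀ x, w (x, 0) = 0 := fun x => by simp [hw, hu.initial, hf]
  have h1 : ∀ x v s, D (x, 0) (v, s) = s * (ε * g x) := fun x v s =>
    h.initial_values hT h0 (by simpa [hw] using hu.initial_deriv x) v s
  have hεg : ∀ x, 0 ≤ ε * g x := fun x => mul_nonneg hε.le (hg_nonneg x)
  have hw0 : ∀ z ∈ (univ : Set (EuclideanSpace ℝ (Fin n))) ×ˢ Ico 0 T, 0 ≤ w z := by
    rintro ⟨x, t⟩ ⟨-, ht⟩
    rcases ht.1.eq_or_lt with h | ht0
    · simp only at h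
      rw [← h, h0]
    · obtain ⟨P, hP⟩ := exists_projection hn
      refine h.nonneg_of_wave (by simp) (EuclideanSpace.basisFun (Fin 3) ℝ) P
        (fun z hz => ?_) hεg h0 h1 x ⟨ht0, ht.2⟩
      rw [hP (fun v => fderiv ℝ D z (v, 0) (v, 0)) (by simp [Prod.mk_zero_zero])]
      have := heq z hz
      have h2 : 0 ≤ |u z.1 z.2| ^ p := by positivity
      linarith
  have hw0' : ∀ z ∈ (univ : Set (EuclideanSpace ℝ (Fin n))) ×ˢ Ioo 0 T, 0 ≤ w z := fun z hz =>
    hw0 z (prod_mono_right Ioo_subset_Ico_self hz)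
  have heq' : ∀ z ∈ (univ : Set (EuclideanSpace ℝ (Fin n))) ×ˢ Ioo 0 T,
      fderiv ℝ D z (0, 1) (0, 1) - ∑ i, fderiv ℝ D z (EuclideanSpace.basisFun (Fin n) ℝ i, 0)
        (EuclideanSpace.basisFun (Fin n) ℝ i, 0) = w z ^ p := fun z hz => by
    rw [heq z hz, abs_of_nonneg (by simpa [hw] using hw0' z hz), hw]
  have hm : (Fintype.card (Fin n) : ℝ) - 1 = 2 * (((n : ℝ) - 1) / 2) := by
    rw [Fintype.card_fin]; ring
  have hm0 : 0 < ((n : ℝ) - 1) / 2 := by linarith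
  have hinit := fun a => charMeanDeriv_initial (m := ((n : ℝ) - 1) / 2) (x₀ := x₀)
    h0 h1 a
  refine ⟨charMean (((n : ℝ) - 1) / 2) x₀ w, charMeanDeriv (((n : ℝ) - 1) / 2) x₀ w D,
    fun a b => h.hasDerivAt_charMean,
    fun a b => h.exists_hasDerivAt_charMeanDeriv (EuclideanSpace.basisFun (Fin n) ℝ) hm hm0.le
      (by linarith) hp heq' hw0',
    fun a b => charMean_nonneg hw0, charMean_self hm0,
    fun b A => h.continuousOn_charMean_left hm0.le, fun Y => h.continuousOn_charMean_line hm0.le,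
    fun a B => h.continuousOn_charMeanDeriv, fun a ha => ?_, fun a ha haδ => ?_⟩
  · rw [hinit]
    exact mul_nonneg (by positivity)
      (mul_nonneg (by norm_num) (integral_nonneg fun x => hεg _))
  · rw [hinit]
    have hc : Continuous fun x => ε * g (x₀ + a • x) := by fun_prop
    have h3 : ε * (2 * γ) ≤ ∫ x, ε * g (x₀ + a • x)
        ∂(unitSphereMeasure (EuclideanSpace ℝ (Fin n))) := by
      have h4 : ∫ x, ε * (2 * γ) ∂(unitSphereMeasure (EuclideanSpace ℝ (Fin n)))
          = ε * (2 * γ) := by simp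
      rw [← h4]
      refine integral_mono_ae (integrable_const _) hc.integrable_unitSphereMeasure ?_
      filter_upwards [ae_norm_eq_one_unitSphereMeasure (EuclideanSpace ℝ (Fin n))] with x hx
      refine mul_le_mul_of_nonneg_left (hγ _ ?_) hε.le
      rw [Metric.mem_closedBall, dist_eq_norm, add_sub_cancel_left, norm_smul, hx, mul_one,
        Real.norm_of_nonneg ha.le]
      exact haδ
    have h5 : 0 ≤ a ^ (((n : ℝ) - 1) / 2) := by positivity
    nlinarith

end Strauss

end

theorem theorem2p1 (n : ℕ) (hn : n = 2 ∨ n = 3) (p : ℝ) (hp : p = straussExponent n)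
    (f g : EuclideanSpace ℝ (Fin n) → ℝ) (hf : ∀ x, f x = 0)
    (hg : ContDiff ℝ ∞ g) (hg_nonneg : ∀ x, 0 ≤ g x) (hg_ne : ∃ x, g x ≠ 0) :
    ∃ C > (0 : ℝ), ∃ ε₀ > (0 : ℝ), ∀ ε : ℝ, 0 < ε → ε ≤ ε₀ →
      (∀ T : ℝ, Real.exp (C * ε ^ (-(p * (p - 1)))) < T →
        ¬ ∃ u : EuclideanSpace ℝ (Fin n) → ℝ → ℝ, IsClassicalSolution n p ε f g T u) ∧
      lifespan n p f g ε ≤ ENNReal.ofReal (Real.exp (C * ε ^ (-(p * (p - 1))))) := by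
  obtain ⟨x₀, hx₀⟩ := hg_ne
  have hgx : 0 < g x₀ := lt_of_le_of_ne (hg_nonneg x₀) hx₀.symm
  obtain ⟨δ, hδ, hball⟩ := Metric.nhds_basis_closedBall.mem_iff.1
    (hg.continuous.continuousAt.preimage_mem_nhds (Ioi_mem_nhds (half_lt_self hgx)))
  have hγ : ∀ x ∈ Metric.closedBall x₀ δ, 2 * (g x₀ / 4) ≤ g x := fun x hx => by
    have : g x₀ / 2 < g x := hball hx
    linarith
  have hn2 : 2 ≤ n := by rcases hn with rfl | rfl <;> norm_num
  have hn2' : (2 : ℝ) ≤ n := by exact_mod_cast hn2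
  obtain ⟨hp1, hmp⟩ := straussExponent_critical hn2 hp
  -- On the ball `g > g x₀ / 2`, and the derivative in `a` halves the initial velocity; hence `g x₀
  -- / 4`.
  obtain ⟨C, hC, hmain⟩ := exists_lifespan_bound (m := ((n : ℝ) - 1) / 2) (γ := g x₀ / 4)
    (by linarith) hp1 hmp hδ (by linarith)
  refine ⟨C, hC, 1, one_pos, fun ε hε hε1 => ?_⟩
  have key : ∀ T : ℝ, (∃ u, IsClassicalSolution n p ε f g T u) →
      T ≤ Real.exp (C * ε ^ (-(p * (p - 1)))) := by
    rintro T ⟨u, hu⟩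
    rcases le_or_gt T 0 with hT | hT
    · exact hT.trans (Real.exp_pos _).le
    · obtain ⟨U, Q, hUQ⟩ := hu.isCharSupersolution hn hp1.le hε hT hf hg.continuous hg_nonneg hγ
      exact hmain ε T hε hε1 hT U Q hUQ
  refine ⟨fun T hT hu => (key T hu).not_gt hT, sSup_le ?_⟩
  rintro τ ⟨T, -, hu, rfl⟩
  exact ENNReal.ofReal_le_ofReal (key T hu)
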